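/- For bounded real sequences $a=(a_n)_{n\in\mathbb Z}$, $b=(b_n)_{n\in\mathbb Z}$ let $J(a,b)$ be the Jacobi operator on $\ell^2(\mathbb Z)$ given by $$(J(a,b)\phi)(n)=a_n\phi(n+1)+a_{n-1}\phi(n-1)+b_n\phi(n).$$ Let $a,b\in\ell^\infty(\mathbb Z)$ be real with $a_n\ge\delta>0$ for all $n$. Then for every $\varepsilon>0$ there exist real sequences $\tilde a,\tilde b\in\ell^\infty(\mathbb Z)$ with $\inf_n\tilde a_n>0$, $\|\tilde a-a\|_\infty<\varepsilon$ and $\|\tilde b-b\|_\infty<\varepsilon$ such that the Jacobi operator $\tilde J=J(\tilde a,\tilde b)$ has purely pure point spectrum with exponentially decaying eigenfunctions. That is: 1. for every $\phi\in\ell^2(\mathbb Z)$ the spectral measure of the self-adjoint operator $\tilde J$ at $\phi$ is a pure point measure (concentrated on a countable set); 2. there is $\gamma>0$ such that for every eigenfunction $u\in\ell^2(\mathbb Z)$ of $\tilde J$ there is a constant $C_u$ with $|u(m)|\le C_u e^{-\gamma|m|}$ for all $m\in\mathbb Z$. -/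

import Mathlib

open MeasureTheory
open scoped ENNReal CompactlySupported

noncomputable section

/-- The Hilbert space `ℓ²(ℤ)` of complex square-summable sequences. -/
abbrev EllTwo : Type := lp (fun _ : ℤ => ℂ) 2

/-- The Banach space `ℓ^∞(ℤ)` of bounded real sequences, with the sup norm. -/
abbrev EllInfty : Type := lp (fun _ : ℤ => ℝ) ∞

/-- The operator of multiplication by a bounded real sequence, `(M_a φ)(n) = a(n) φ(n)`. -/
def mulOp (a : EllInfty) : EllTwo →L[ℂ] EllTwo :=
  lp.mapCLM 2 (fun n => (a n : ℂ) • ContinuousLinearMap.id ℂ ℂ) (norm_nonneg a) (fun n => by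
    rw [norm_smul, ContinuousLinearMap.norm_id, mul_one, Complex.norm_real]
    exact lp.norm_apply_le_norm ENNReal.top_ne_zero a n)

theorem memℓp_shift (k : ℤ) (φ : EllTwo) : Memℓp (fun n : ℤ => φ (n + k)) 2 := by
  have h : (0 : ℝ) < (2 : ℝ≥0∞).toReal := by norm_num
  rw [memℓp_gen_iff h]
  exact ((memℓp_gen_iff h).1 (lp.memℓp φ)).comp_injective (add_left_injective k)

/-- The shift `(S_k φ)(n) = φ(n + k)`, an isometry of `ℓ²(ℤ)`. -/
def shiftOp (k : ℤ) : EllTwo →ₗᵢ[ℂ] EllTwo where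
  toFun φ := ⟨fun n => φ (n + k), memℓp_shift k φ⟩
  map_add' _ _ := rfl
  map_smul' _ _ := rfl
  norm_map' φ := by
    have h : (0 : ℝ) < (2 : ℝ≥0∞).toReal := by norm_num
    rw [lp.norm_eq_tsum_rpow h, lp.norm_eq_tsum_rpow h]
    congr 1
    exact (Equiv.addRight k).tsum_eq (fun n => ‖φ n‖ ^ (2 : ℝ≥0∞).toReal)

/-- The Jacobi operator `J(a,b)` on `ℓ²(ℤ)` with bounded real coefficients; the defining formula
`(J φ)(n) = a(n) φ(n+1) + a(n-1) φ(n-1) + b(n) φ(n)` is `jacobi_apply`. -/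
def jacobi (a b : EllInfty) : EllTwo →L[ℂ] EllTwo :=
  mulOp a ∘L (shiftOp 1).toContinuousLinearMap
    + (shiftOp (-1)).toContinuousLinearMap ∘L mulOp a + mulOp b

theorem jacobi_apply (a b : EllInfty) (φ : EllTwo) (n : ℤ) :
    jacobi a b φ n = a n * φ (n + 1) + a (n - 1) * φ (n - 1) + b n * φ n := rfl

section Spectral

variable {H : Type*} [NormedAddCommGroup H] [InnerProductSpace ℂ H] [CompleteSpace H]

/-- The positive functional `f ↦ ⟪φ, f(T) φ⟫` on `C_c(ℝ)`, with `f(T)` given by the continuous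
functional calculus of the self-adjoint operator `T`. (For real `f` the inner product is real.) -/
def spectralFunctional (T : H →L[ℂ] H) (φ : H) : C_c(ℝ, ℝ) →ₚ[ℝ] ℝ :=
  PositiveLinearMap.mk₀
    { toFun := fun f => (inner ℂ φ (cfc (fun x : ℝ => f x) T φ)).re
      map_add' := fun f g => by
        have h : cfc (fun x : ℝ => (f + g) x) T
            = cfc (fun x : ℝ => f x) T + cfc (fun x : ℝ => g x) T :=
          cfc_add (fun x : ℝ => f x) (fun x : ℝ => g x) (a := T)
            f.continuous.continuousOn g.continuous.continuousOn
        rw [h, add_apply, inner_add_right, Complex.add_re]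
      map_smul' := fun c f => by
        have h : cfc (fun x : ℝ => (c • f) x) T = c • cfc (fun x : ℝ => f x) T :=
          cfc_smul c (fun x : ℝ => f x) (a := T) f.continuous.continuousOn
        rw [h, smul_apply, ← Complex.coe_smul, inner_smul_right]
        simp }
    (fun f hf => by
      have h : 0 ≤ cfc (fun x : ℝ => f x) T := cfc_nonneg (fun x _ => hf x)
      have h2 := ((ContinuousLinearMap.nonneg_iff_isPositive _).1 h).re_inner_nonneg_right φ
      exact h2)

/-- The spectral measure of the self-adjoint operator `T` at the vector `φ`: the regular Borel
measure `μ` on `ℝ` with `∫ f dμ = ⟪φ, f(T) φ⟫` for all `f ∈ C_c(ℝ)`. -/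
def spectralMeasure (T : H →L[ℂ] H) (φ : H) : Measure ℝ :=
  RealRMK.rieszMeasure (spectralFunctional T φ)

theorem integral_spectralMeasure (T : H →L[ℂ] H) (φ : H) (f : C_c(ℝ, ℝ)) :
    ∫ x, f x ∂(spectralMeasure T φ) = (inner ℂ φ (cfc (fun x : ℝ => f x) T φ)).re :=
  RealRMK.integral_rieszMeasure (spectralFunctional T φ) f

/-- A measure on `ℝ` is a pure point measure if it is concentrated on a countable set. -/
def IsPurePointMeasure (μ : Measure ℝ) : Prop :=
  ∃ S : Set ℝ, S.Countable ∧ μ Sᶜ = 0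

/-- A bounded self-adjoint operator has purely pure point spectrum if all its spectral measures
are pure point measures. -/
def HasPurelyPurePointSpectrum (T : H →L[ℂ] H) : Prop :=
  IsSelfAdjoint T ∧ ∀ φ : H, IsPurePointMeasure (spectralMeasure T φ)

end Spectral

/-- The eigenfunctions of the operator `T` on `ℓ²(ℤ)` decay exponentially: there is a rate
`γ > 0` such that every eigenfunction `u` satisfies `|u(m)| ≤ C_u e^{-γ|m|}` for all `m ∈ ℤ`. -/
def HasExpDecayingEigenfunctions (T : EllTwo →L[ℂ] EllTwo) : Prop :=
  ∃ γ : ℝ, 0 < γ ∧ ∀ (E : ℂ) (u : EllTwo),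
    Module.End.HasEigenvector (T : EllTwo →ₗ[ℂ] EllTwo) E u →
      ∃ C : ℝ, ∀ m : ℤ, ‖u m‖ ≤ C * Real.exp (-γ * |(m : ℝ)|)

end

/-! Only the potential is changed. Give each site an independent perturbation uniform on `[0, 2η]`,
that is, a uniform variable on `[0, η]` plus `η` times a fair coin. Then the reciprocal norm of a
transferred vector has exponentially small mean, uniformly in the energy and the background. In the
projective coordinate a transfer step acts on L² as an inversion followed by a reflection and a
translation, hence unitarily, and the coin averages the result with its translate by `η`. Averaging
loses norm unless the function is nearly `η`-periodic. Since the inversion exchanges the inside and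
the outside of `[-a, a]`, a function cannot be nearly periodic both before and after it, so two
steps contract (`exists_contraction`, `exists_avgInvNorm_le`). Fixing the potential site by site,
never above the conditional mean, gives for every length a half-line potential whose exponentially
weighted solution sum has a bounded energy integral (`exists_halfLineSum_integral_le`).

Energy integrals say nothing directly about the eigenvalues of a box. The sites `0` and `1` do not
enter the half-line sums, so a common coupling `t` there is still free, and spectral averaging over
this rank-two perturbation turns the integral into a sum over eigenvalues weighted by the mass at
`0` and `1` (`exists_spectral_average`). The result is an eigenbasis of each box with decay
constants controlled uniformly in the length (`exists_localized_box`).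

The potentials of the boxes converge along an ultrafilter. If `w` does not vanish at `0` and `1`,
some eigenfunction of each box has a controlled decay constant and an overlap with `w` bounded below
relative to its size at `0` and `1`; these have a decaying eigenfunction as limit, and it is not
orthogonal to `w` (`exists_potential_complete`). The orthogonal complement of the decaying
eigenfunctions is invariant under the operator, so vanishing at `0` and `1` makes it trivial.
Totality gives pure point spectrum; simplicity of the eigenvalues makes every eigenfunction a
multiple of a decaying one. -/

/-! ### Inversion, translation and the two-step contraction on L²(ℝ) -/

/-- The integral of `h²` over `ℝ`, as an extended nonnegative real. -/
noncomputable def sqInt (h : ℝ → ℝ) : ℝ≥0∞ := ∫⁻ x, ENNReal.ofReal (h x ^ 2)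

/-- The unitary operator `h ↦ (a / |w|) h(a² / w)` on `L²(ℝ)`. -/
noncomputable def inversion (a : ℝ) (h : ℝ → ℝ) (w : ℝ) : ℝ := a / |w| * h (a ^ 2 / w)

theorem measurable_inversion (a : ℝ) {h : ℝ → ℝ} (hh : Measurable h) :
    Measurable (inversion a h) := by
  unfold inversion
  fun_prop

/-- The square of the factor `a / |w|` is the Jacobian of `w ↦ a² / w`; the origin is excluded as
the singular point of this map. -/
theorem lintegral_inversion {a : ℝ} (ha : 0 < a) (h : ℝ → ℝ) {s : Set ℝ} (hs : MeasurableSet s)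
    (hs0 : (0 : ℝ) ∉ s) :
    ∫⁻ w in s, ENNReal.ofReal (inversion a h w ^ 2)
      = ∫⁻ y in (fun w => a ^ 2 / w) '' s, ENNReal.ofReal (h y ^ 2) := by
  rw [lintegral_image_eq_lintegral_abs_deriv_mul (f' := fun w => -(a ^ 2) / w ^ 2) hs]
  · refine setLIntegral_congr_fun hs fun w hw => ?_
    have hw0 : w ≠ 0 := fun h => hs0 (h ▸ hw)
    simp only [inversion]
    rw [← ENNReal.ofReal_mul (abs_nonneg _)]
    congr 1
    rw [mul_pow, div_pow, sq_abs, abs_div, abs_neg, abs_of_nonneg (sq_nonneg a),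
      abs_of_nonneg (sq_nonneg w)]
  · intro w hw
    have hw0 : w ≠ 0 := fun h => hs0 (h ▸ hw)
    have := (HasDerivAt.fun_div (hasDerivAt_const w (a ^ 2)) (hasDerivAt_id' w) hw0).hasDerivWithinAt
      (s := s)
    simpa only [id, zero_mul, mul_one, zero_sub] using this
  · intro x hx y hy hxy
    have hx0 : x ≠ 0 := fun h => hs0 (h ▸ hx)
    have hy0 : y ≠ 0 := fun h => hs0 (h ▸ hy)
    have ha0 : a ≠ 0 := ha.ne'
    simp only at hxy
    field_simp at hxy
    exact hxy.symm

theorem sqInt_inversion {a : ℝ} (ha : 0 < a) (h : ℝ → ℝ) : sqInt (inversion a h) = sqInt h := by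
  have hz : ∀ g : ℝ → ℝ≥0∞, ∫⁻ x in ({0}ᶜ : Set ℝ), g x = ∫⁻ x, g x := fun g => by
    rw [restrict_compl_singleton]
  unfold sqInt
  rw [← hz, lintegral_inversion ha h (measurableSet_singleton 0).compl (by simp), ← hz]
  congr 2
  ext y
  simp only [Set.mem_image, Set.mem_compl_iff, Set.mem_singleton_iff]
  have ha0 : a ≠ 0 := ha.ne'
  constructor
  · rintro ⟨w, hw, rfl⟩
    positivity
  · intro hy
    exact ⟨a ^ 2 / y, by positivity, by field_simp⟩

/-- Every point outside `[-a, a]` is the image under `w ↦ a² / w` of a nonzero point inside, so the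
outer mass of `h` reappears as inner mass of its inversion. -/
theorem sqInt_le_add_inversion {a : ℝ} (ha : 0 < a) (h : ℝ → ℝ) :
    sqInt h ≤ (∫⁻ x in Set.Icc (-a) a, ENNReal.ofReal (h x ^ 2))
      + ∫⁻ x in Set.Icc (-a) a, ENNReal.ofReal (inversion a h x ^ 2) := by
  have hI : MeasurableSet (Set.Icc (-a) a) := measurableSet_Icc
  unfold sqInt
  rw [← lintegral_add_compl _ hI]
  refine add_le_add le_rfl ?_
  have h1 : ∫⁻ x in Set.Icc (-a) a \ {0}, ENNReal.ofReal (inversion a h x ^ 2)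
      ≤ ∫⁻ x in Set.Icc (-a) a, ENNReal.ofReal (inversion a h x ^ 2) :=
    lintegral_mono_set Set.sdiff_subset
  refine le_trans ?_ h1
  rw [lintegral_inversion ha h (hI.diff (measurableSet_singleton 0)) (by simp)]
  refine lintegral_mono_set fun y hy => ?_
  have hya : a < |y| := by
    by_contra hc
    exact hy (abs_le.1 (not_lt.1 hc))
  have hy0 : y ≠ 0 := by
    rintro rfl
    simp at hya
    linarith
  have ha0 : a ≠ 0 := ha.ne'
  refine ⟨a ^ 2 / y, ⟨abs_le.1 ?_, by simp [ha0, hy0]⟩, by simp only; field_simp⟩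
  rw [abs_div, abs_of_nonneg (sq_nonneg a), div_le_iff₀ (by positivity)]
  nlinarith

theorem ofReal_sq_add_le (x y : ℝ) :
    ENNReal.ofReal ((x + y) ^ 2) ≤ 2 * ENNReal.ofReal (x ^ 2) + 2 * ENNReal.ofReal (y ^ 2) := by
  have h2 : (2 : ℝ≥0∞) = ENNReal.ofReal 2 := by simp
  rw [h2, ← ENNReal.ofReal_mul (by norm_num), ← ENNReal.ofReal_mul (by norm_num),
    ← ENNReal.ofReal_add (by positivity) (by positivity)]
  exact ENNReal.ofReal_le_ofReal (by nlinarith [sq_nonneg (x - y)])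

theorem setLIntegral_sq_add_le (s : Set ℝ) {f g : ℝ → ℝ} (hf : Measurable f) (hg : Measurable g) :
    ∫⁻ x in s, ENNReal.ofReal ((f x + g x) ^ 2)
      ≤ 2 * (∫⁻ x in s, ENNReal.ofReal (f x ^ 2)) + 2 * ∫⁻ x in s, ENNReal.ofReal (g x ^ 2) := by
  rw [← lintegral_const_mul _ (by fun_prop), ← lintegral_const_mul _ (by fun_prop),
    ← lintegral_add_left (by fun_prop)]
  exact lintegral_mono fun x => ofReal_sq_add_le _ _

theorem sqInt_add_le {f g : ℝ → ℝ} (hf : Measurable f) (hg : Measurable g) :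
    sqInt (fun x => f x + g x) ≤ 2 * sqInt f + 2 * sqInt g := by
  simpa [sqInt] using setLIntegral_sq_add_le Set.univ hf hg

theorem sqInt_comp_sub (h : ℝ → ℝ) (t : ℝ) : sqInt (fun x => h (x - t)) = sqInt h :=
  lintegral_sub_right_eq_self (fun x => ENNReal.ofReal (h x ^ 2)) t

theorem sqInt_comp_sub_left (h : ℝ → ℝ) (t : ℝ) : sqInt (fun x => h (t - x)) = sqInt h :=
  lintegral_sub_left_eq_self (fun x => ENNReal.ofReal (h x ^ 2)) t

/-- The squared `L²` distance of `h` from its translate by `η`. -/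
noncomputable def shiftDefect (η : ℝ) (h : ℝ → ℝ) : ℝ≥0∞ := sqInt (fun x => h x - h (x - η))

/-- Telescoping into `k` translations by `η`. The crude factor `4 ^ k` is harmless because `k` will
be bounded in terms of `A` and `η`. -/
theorem shiftDefect_nat_mul_le (η : ℝ) {h : ℝ → ℝ} (hh : Measurable h) (k : ℕ) :
    shiftDefect (k * η) h ≤ 4 ^ k * shiftDefect η h := by
  induction k with
  | zero => simp [shiftDefect, sqInt]
  | succ k ih =>
    have h1 : shiftDefect ((k + 1 : ℕ) * η) h
        = sqInt (fun x => (h x - h (x - k * η)) + (fun y => h y - h (y - η)) (x - k * η)) := by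
      unfold shiftDefect
      congr 1
      ext x
      push_cast
      ring_nf
    rw [h1]
    refine (sqInt_add_le (by fun_prop) (by fun_prop)).trans ?_
    rw [sqInt_comp_sub (fun y => h y - h (y - η))]
    change 2 * shiftDefect (k * η) h + 2 * shiftDefect η h ≤ _
    have h4 : (1 : ℝ≥0∞) ≤ 4 ^ k := one_le_pow₀ (by norm_num)
    calc 2 * shiftDefect (k * η) h + 2 * shiftDefect η h
        ≤ 2 * (4 ^ k * shiftDefect η h) + 2 * (4 ^ k * shiftDefect η h) := by
          gcongr
          exact le_mul_of_one_le_left (zero_le) h4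
      _ = 4 ^ (k + 1) * shiftDefect η h := by ring

theorem setLIntegral_translate_le (s : Set ℝ) (t : ℝ) {h : ℝ → ℝ}
    (hh : Measurable h) :
    ∫⁻ x in s, ENNReal.ofReal (h x ^ 2)
      ≤ 2 * (∫⁻ x in (fun y => y + t) ⁻¹' s, ENNReal.ofReal (h x ^ 2)) + 2 * shiftDefect t h := by
  have h1 := setLIntegral_sq_add_le s (f := fun x => h (x - t)) (g := fun x => h x - h (x - t))
    (by fun_prop) (by fun_prop)
  simp only [add_sub_cancel] at h1
  refine h1.trans (add_le_add (mul_le_mul_right ?_ 2) (mul_le_mul_right ?_ 2))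
  · have hmp : MeasurePreserving (fun x : ℝ => x + t) volume volume :=
      measurePreserving_add_right volume t
    have := hmp.setLIntegral_comp_preimage_emb (MeasurableEquiv.addRight t).measurableEmbedding
      (fun x => ENNReal.ofReal (h (x - t) ^ 2)) s
    simp only [add_sub_cancel_right] at this
    exact this.ge
  · exact setLIntegral_le_lintegral _ _

/-- The eight translates of `[-a, a]` by multiples of `p * η` are disjoint by `hp`. Up to a factor
two and the defect, each carries at least the mass on `[-a, a]`, so a nearly periodic function has
at most about a quarter of its mass there. -/
theorem setLIntegral_Icc_le {η : ℝ} (p : ℕ) {a : ℝ} (hp : 2 * a < p * η)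
    {h : ℝ → ℝ} (hh : Measurable h) :
    8 * ∫⁻ x in Set.Icc (-a) a, ENNReal.ofReal (h x ^ 2)
      ≤ 2 * sqInt h + 2 * (∑ k ∈ Finset.range 8, 4 ^ (k * p)) * shiftDefect η h := by
  have h1 : ∀ k ∈ Finset.range 8, ∫⁻ x in Set.Icc (-a) a, ENNReal.ofReal (h x ^ 2)
      ≤ 2 * (∫⁻ x in (fun y => y + ((k * p : ℕ) : ℝ) * η) ⁻¹' (Set.Icc (-a) a),
        ENNReal.ofReal (h x ^ 2)) + 2 * (4 ^ (k * p) * shiftDefect η h) := fun k _ => by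
    refine (setLIntegral_translate_le _ (((k * p : ℕ) : ℝ) * η) hh).trans ?_
    gcongr
    exact shiftDefect_nat_mul_le η hh _
  have h2 := Finset.sum_le_sum h1
  rw [Finset.sum_const, Finset.card_range, nsmul_eq_mul, Finset.sum_add_distrib, ← Finset.mul_sum,
    ← Finset.mul_sum, ← Finset.sum_mul, ← lintegral_biUnion_finset, ← mul_assoc] at h2
  · refine (by simpa using h2 : _ ≤ _).trans ?_
    gcongr
    exact setLIntegral_le_lintegral _ _
  · intro i _ j _ hij
    refine Set.disjoint_left.2 fun x hx hx' => ?_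
    simp only [Set.mem_preimage, Set.mem_Icc] at hx hx'
    push_cast at hx hx'
    rcases lt_or_gt_of_ne hij with h | h
    · have : (i : ℝ) + 1 ≤ j := by exact_mod_cast h
      nlinarith
    · have : (j : ℝ) + 1 ≤ i := by exact_mod_cast h
      nlinarith
  · intro k _
    exact measurableSet_Icc.preimage (by fun_prop)

/-- If both `h` and its inversion were nearly `η`-periodic, at most about a quarter of the mass
would lie inside `[-a, a]` and a quarter outside. The missing half must be paid for by the two
defects. -/
theorem sqInt_le_shiftDefect {η : ℝ} (p : ℕ) {a : ℝ} (ha : 0 < a)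
    (hp : 2 * a < p * η) {h : ℝ → ℝ} (hh : Measurable h) (hfin : sqInt h ≠ ∞) :
    4 * sqInt h ≤ 2 * (∑ k ∈ Finset.range 8, 4 ^ (k * p))
      * (shiftDefect η h + shiftDefect η (inversion a h)) := by
  have h1 := setLIntegral_Icc_le p hp hh
  have h2 := setLIntegral_Icc_le p hp (measurable_inversion a hh)
  rw [sqInt_inversion ha] at h2
  have h3 := sqInt_le_add_inversion ha h
  set C : ℝ≥0∞ := 2 * (∑ k ∈ Finset.range 8, 4 ^ (k * p))
  have h4 : 8 * sqInt h ≤ 4 * sqInt h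
      + C * (shiftDefect η h + shiftDefect η (inversion a h)) := by
    calc 8 * sqInt h ≤ 8 * (_ + _) := by gcongr
      _ = 8 * _ + 8 * _ := mul_add _ _ _
      _ ≤ _ := add_le_add h1 h2
      _ = _ := by ring
  have h5 : 8 * sqInt h = 4 * sqInt h + 4 * sqInt h := by ring
  rw [h5] at h4
  exact (ENNReal.add_le_add_iff_left (ENNReal.mul_ne_top (by norm_num) hfin)).1 h4

/-- The average `y ↦ (φ(c - y) + φ(c - η - y)) / 2`. -/
noncomputable def halfAvg (η c : ℝ) (φ : ℝ → ℝ) (y : ℝ) : ℝ := (φ (c - y) + φ (c - η - y)) / 2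

theorem measurable_halfAvg (η c : ℝ) {φ : ℝ → ℝ} (hφ : Measurable φ) :
    Measurable (halfAvg η c φ) := by
  unfold halfAvg
  fun_prop

/-- Parallelogram identity: the norm lost by averaging is exactly the defect. -/
theorem sqInt_halfAvg (η c : ℝ) {φ : ℝ → ℝ} (hφ : Measurable φ) :
    4 * sqInt (halfAvg η c φ) + shiftDefect η φ = 4 * sqInt φ := by
  have h0 : sqInt (halfAvg η c φ) = sqInt (fun x => (φ x + φ (x - η)) / 2) := by
    rw [← sqInt_comp_sub_left (fun x => (φ x + φ (x - η)) / 2) c]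
    unfold halfAvg
    congr 1
    ext y
    rw [sub_right_comm]
  have h2 : sqInt (fun x => φ (x - η)) = sqInt φ := sqInt_comp_sub φ η
  have h3 : 4 * sqInt φ = 2 * sqInt φ + 2 * sqInt (fun x => φ (x - η)) := by rw [h2]; ring
  rw [h3, h0]
  unfold shiftDefect sqInt
  rw [← lintegral_const_mul _ (by fun_prop), ← lintegral_const_mul _ (by fun_prop),
    ← lintegral_const_mul _ (by fun_prop), ← lintegral_add_left (by fun_prop),
    ← lintegral_add_left (by fun_prop)]
  congr 1
  ext x
  have e2 : (2 : ℝ≥0∞) = ENNReal.ofReal 2 := by simp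
  have e4 : (4 : ℝ≥0∞) = ENNReal.ofReal 4 := by simp
  rw [e2, e4, ← ENNReal.ofReal_mul (by norm_num), ← ENNReal.ofReal_mul (by norm_num),
    ← ENNReal.ofReal_mul (by norm_num), ← ENNReal.ofReal_add (by positivity) (by positivity),
    ← ENNReal.ofReal_add (by positivity) (by positivity)]
  ring_nf

theorem sqInt_halfAvg_le (η c : ℝ) {φ : ℝ → ℝ} (hφ : Measurable φ) :
    sqInt (halfAvg η c φ) ≤ sqInt φ := by
  have h := le_self_add.trans (sqInt_halfAvg η c hφ).le
  exact (ENNReal.mul_le_mul_iff_right (by norm_num) (by norm_num)).1 h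

theorem shiftDefect_halfAvg_le (η c : ℝ) {φ : ℝ → ℝ} (hφ : Measurable φ) :
    shiftDefect η (halfAvg η c φ) ≤ 4 * shiftDefect η φ := by
  have h0 : shiftDefect η (halfAvg η c φ)
      = sqInt (fun x => (fun y => (-1 / 2 : ℝ) * (φ y - φ (y - η))) (c - x + η)
        + (-1 / 2) * (φ (c - x) - φ (c - x - η))) := by
    unfold shiftDefect halfAvg
    congr 1
    ext x
    ring_nf
  have h1 : ∀ t : ℝ, sqInt (fun x => (fun y => (-1 / 2 : ℝ) * (φ y - φ (y - η))) (c - x + t))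
      ≤ shiftDefect η φ := fun t => by
    have := sqInt_comp_sub_left (fun y => (-1 / 2 : ℝ) * (φ y - φ (y - η))) (c + t)
    have e : ∀ x, c - x + t = c + t - x := fun x => by ring
    simp only [e]
    rw [this]
    refine lintegral_mono fun x => ENNReal.ofReal_le_ofReal ?_
    nlinarith [sq_nonneg (φ x - φ (x - η))]
  rw [h0]
  refine (sqInt_add_le (by fun_prop) (by fun_prop)).trans ?_
  have h2 := h1 η
  have h3 := h1 0
  simp only [add_zero] at h3
  calc _ ≤ 2 * shiftDefect η φ + 2 * shiftDefect η φ := by gcongr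
    _ = _ := by ring

/-- Two averaged transfer steps contract `L²(ℝ)`, uniformly in the couplings and the shifts. -/
theorem exists_contraction {η : ℝ} (hη : 0 < η) (A : ℝ) :
    ∃ ρ : ℝ≥0∞, ρ < 1 ∧ ∀ (a₁ a₂ c₁ c₂ : ℝ) (f : ℝ → ℝ), 0 < a₁ → 0 < a₂ → a₂ ≤ A →
      Measurable f → sqInt f ≠ ∞ →
      sqInt (halfAvg η c₂ (inversion a₂ (halfAvg η c₁ (inversion a₁ f)))) ≤ ρ * sqInt f := by
  obtain ⟨p, hp⟩ := exists_nat_gt (2 * A / η)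
  rw [div_lt_iff₀ hη] at hp
  set C : ℝ≥0∞ := 2 * (∑ k ∈ Finset.range 8, 4 ^ (k * p)) with hC
  have hCtop : C ≠ ∞ := by
    refine ENNReal.mul_ne_top (by norm_num) (ENNReal.sum_ne_top.2 fun k _ => ?_)
    exact ENNReal.pow_ne_top (by norm_num)
  have hden : 4 + 16 * C ≠ ∞ :=
    ENNReal.add_ne_top.2 ⟨by norm_num, ENNReal.mul_ne_top (by norm_num) hCtop⟩
  -- The bound `4 * sqInt g ≤ C * (shiftDefect η g + shiftDefect η ψ)` and the two parallelogram
  -- identities combine to `(4 + 16 * C) * N ≤ 16 * C * sqInt f`, where `N` is the final squared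
  -- norm; `ρ` is this quotient.
  refine ⟨16 * C / (4 + 16 * C), ?_, ?_⟩
  · refine ENNReal.div_lt_of_lt_mul ?_
    rw [one_mul, add_comm]
    exact ENNReal.lt_add_right (ENNReal.mul_ne_top (by norm_num) hCtop) (by norm_num)
  · intro a₁ a₂ c₁ c₂ f h1 h2 h2A hf hfin
    set φ := inversion a₁ f with hφ
    have mφ : Measurable φ := measurable_inversion a₁ hf
    set g := halfAvg η c₁ φ with hg
    have mg : Measurable g := measurable_halfAvg η c₁ mφ
    set ψ := inversion a₂ g with hψ
    have mψ : Measurable ψ := measurable_inversion a₂ mg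
    set N := sqInt (halfAvg η c₂ ψ)
    have eφ : sqInt φ = sqInt f := sqInt_inversion h1 f
    have eψ : sqInt ψ = sqInt g := sqInt_inversion h2 g
    have i1 : 4 * sqInt g + shiftDefect η φ = 4 * sqInt φ := sqInt_halfAvg η c₁ mφ
    have i2 : 4 * N + shiftDefect η ψ = 4 * sqInt ψ := sqInt_halfAvg η c₂ mψ
    have i3 : shiftDefect η g ≤ 4 * shiftDefect η φ := shiftDefect_halfAvg_le η c₁ mφ
    have i4 : sqInt g ≤ sqInt φ := sqInt_halfAvg_le η c₁ mφ
    have i5 : N ≤ sqInt g := (sqInt_halfAvg_le η c₂ mψ).trans eψ.le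
    have i6 := sqInt_le_shiftDefect (η := η) p h2 (by linarith) mg (ne_top_of_le_ne_top hfin (i4.trans eφ.le))
    rw [← hC] at i6
    have key : (4 + 16 * C) * N ≤ 16 * C * sqInt f := by
      calc (4 + 16 * C) * N = 4 * N + 4 * C * (4 * N) := by ring
        _ ≤ 4 * sqInt g + 4 * C * (4 * N) := by gcongr
        _ ≤ C * (shiftDefect η g + shiftDefect η ψ) + 4 * C * (4 * N) := by gcongr
        _ ≤ C * (4 * shiftDefect η φ + 4 * shiftDefect η ψ) + 4 * C * (4 * N) := by
            gcongr
            exact le_mul_of_one_le_left (zero_le) (by norm_num)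
        _ = 4 * C * (4 * N + shiftDefect η ψ + shiftDefect η φ) := by ring
        _ = 4 * C * (4 * sqInt f) := by rw [i2, eψ, i1, eφ]
        _ = _ := by ring
    rw [← ENNReal.mul_div_right_comm, ENNReal.le_div_iff_mul_le (by simp) (Or.inl hden), mul_comm]
    exact key

/-! ### Averages over the uniform law -/

/-- The average of `g` over `[0, η]`. -/
noncomputable def unifAvg (η : ℝ) (g : ℝ → ℝ≥0∞) : ℝ≥0∞ :=
  (ENNReal.ofReal η)⁻¹ * ∫⁻ s in Set.Icc 0 η, g s

theorem unifAvg_mono (η : ℝ) {f g : ℝ → ℝ≥0∞} (h : ∀ s, f s ≤ g s) :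
    unifAvg η f ≤ unifAvg η g := by
  unfold unifAvg
  gcongr
  exact h _

theorem unifAvg_congr_ae (η : ℝ) {f g : ℝ → ℝ≥0∞} (h : f =ᵐ[volume] g) :
    unifAvg η f = unifAvg η g := by
  unfold unifAvg
  rw [lintegral_congr_ae (ae_restrict_of_ae h)]

theorem unifAvg_const {η : ℝ} (hη : 0 < η) (c : ℝ≥0∞) : unifAvg η (fun _ => c) = c := by
  unfold unifAvg
  rw [setLIntegral_const, Real.volume_Icc, sub_zero, mul_comm c, ← mul_assoc,
    ENNReal.inv_mul_cancel (by simpa using hη) ENNReal.ofReal_ne_top, one_mul]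

theorem unifAvg_const_mul (η : ℝ) (c : ℝ≥0∞) {g : ℝ → ℝ≥0∞} (hg : Measurable g) :
    unifAvg η (fun s => c * g s) = c * unifAvg η g := by
  unfold unifAvg
  rw [lintegral_const_mul _ hg, mul_left_comm]

theorem unifAvg_add (η : ℝ) {f g : ℝ → ℝ≥0∞} (hf : Measurable f) :
    unifAvg η (fun s => f s + g s) = unifAvg η f + unifAvg η g := by
  unfold unifAvg
  rw [lintegral_add_left hf, mul_add]

theorem measurable_unifAvg {X : Type*} [MeasurableSpace X] (η : ℝ) {g : X → ℝ → ℝ≥0∞}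
    (hg : Measurable (fun z : X × ℝ => g z.1 z.2)) : Measurable (fun x => unifAvg η (g x)) := by
  unfold unifAvg
  exact (Measurable.lintegral_prod_right' hg).const_mul _

theorem lintegral_unifAvg {X : Type*} [MeasurableSpace X] (μ : Measure X) [SFinite μ] (η : ℝ)
    {g : X → ℝ → ℝ≥0∞} (hg : Measurable (fun z : X × ℝ => g z.1 z.2)) :
    ∫⁻ x, unifAvg η (g x) ∂μ = unifAvg η (fun s => ∫⁻ x, g x s ∂μ) := by
  unfold unifAvg
  rw [lintegral_const_mul _ (Measurable.lintegral_prod_right' hg),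
    lintegral_lintegral_swap hg.aemeasurable]

theorem unifAvg_sq_le {η : ℝ} (hη : 0 < η) {g : ℝ → ℝ≥0∞} (hg : Measurable g) :
    unifAvg η g ^ 2 ≤ unifAvg η (fun s => g s ^ 2) := by
  have h := ENNReal.lintegral_mul_le_Lp_mul_Lq (volume.restrict (Set.Icc 0 η))
    Real.HolderConjugate.two_two hg.aemeasurable (measurable_const (a := (1 : ℝ≥0∞))).aemeasurable
  simp only [Pi.mul_apply, mul_one, lintegral_const, Measure.restrict_apply_univ,
    Real.volume_Icc, sub_zero, ENNReal.rpow_ofNat] at h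
  have h2 : (∫⁻ s in Set.Icc 0 η, g s) ^ 2
      ≤ (∫⁻ s in Set.Icc 0 η, g s ^ 2) * ENNReal.ofReal η := by
    refine (pow_le_pow_left' h 2).trans ?_
    rw [mul_pow, ← ENNReal.rpow_mul_natCast, ← ENNReal.rpow_mul_natCast]
    norm_num
  unfold unifAvg
  rw [mul_pow]
  calc (ENNReal.ofReal η)⁻¹ ^ 2 * (∫⁻ s in Set.Icc 0 η, g s) ^ 2
      ≤ (ENNReal.ofReal η)⁻¹ ^ 2 * ((∫⁻ s in Set.Icc 0 η, g s ^ 2) * ENNReal.ofReal η) := by gcongr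
    _ = (ENNReal.ofReal η)⁻¹ * (∫⁻ s in Set.Icc 0 η, g s ^ 2)
        * ((ENNReal.ofReal η)⁻¹ * ENNReal.ofReal η) := by ring
    _ = _ := by
      rw [ENNReal.inv_mul_cancel (by simpa using hη) ENNReal.ofReal_ne_top, mul_one]

theorem exists_le_unifAvg {η : ℝ} (hη : 0 < η) {g : ℝ → ℝ≥0∞} (hg : Measurable g) :
    ∃ s ∈ Set.Icc 0 η, g s ≤ unifAvg η g := by
  have hv : volume (Set.Icc 0 η) = ENNReal.ofReal η := by simp
  obtain ⟨s, hs, h⟩ := exists_le_setLAverage (μ := volume) (s := Set.Icc 0 η) (f := g)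
    (by rw [hv]; simpa using hη) (by rw [hv]; exact ENNReal.ofReal_ne_top) hg.aemeasurable
  refine ⟨s, hs, h.trans_eq ?_⟩
  rw [setLAverage_eq, hv, unifAvg, mul_comm, ENNReal.div_eq_inv_mul, mul_comm]

/-! ### Exponential decay of the mean reciprocal norm of transferred vectors -/

/-- The transfer step of a Jacobi recursion with coupling `α`, applied to `(p, q)`. -/
noncomputable def transferStep (α x : ℝ) (v : ℝ × ℝ) : ℝ × ℝ := (α * v.2, (x * v.2 - v.1) / α)

/-- The reciprocal of the Euclidean norm on `ℝ × ℝ`. -/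
noncomputable def invNorm (v : ℝ × ℝ) : ℝ≥0∞ := ENNReal.ofReal (1 / √(v.1 ^ 2 + v.2 ^ 2))

/-- The mean of the reciprocal norm of `v` after transfer through the sites `n, n - 1, …, 1`, when
the potential at the site `k` is `β k + s + η ξ` with `s` uniform on `[0, η]` and `ξ` a fair coin. -/
noncomputable def avgInvNorm (α β : ℕ → ℝ) (η E : ℝ) : ℕ → ℝ × ℝ → ℝ≥0∞
  | 0, v => invNorm v
  | n + 1, v => unifAvg η (fun s =>
      (avgInvNorm α β η E n (transferStep (α n) (E - β (n + 1) - s) v)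
        + avgInvNorm α β η E n (transferStep (α n) (E - β (n + 1) - η - s) v)) / 2)

section

variable (α β : ℕ → ℝ) (η : ℝ)

theorem measurable_invNorm : Measurable invNorm := by
  unfold invNorm
  fun_prop

theorem measurable_avgInvNorm (n : ℕ) :
    Measurable (fun z : ℝ × ℝ × ℝ => avgInvNorm α β η z.1 n z.2) := by
  induction n with
  | zero => exact measurable_invNorm.comp measurable_snd
  | succ n ih =>
    simp only [avgInvNorm]
    refine measurable_unifAvg η (g := fun (z : ℝ × ℝ × ℝ) s => _) ?_
    have h : ∀ c : ℝ, Measurable (fun z : (ℝ × ℝ × ℝ) × ℝ =>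
        avgInvNorm α β η z.1.1 n (transferStep (α n) (z.1.1 - β (n + 1) - c - z.2) z.1.2)) :=
      fun c => ih.comp (g := fun z : ℝ × ℝ × ℝ => avgInvNorm α β η z.1 n z.2)
        (f := fun z : (ℝ × ℝ × ℝ) × ℝ =>
          (z.1.1, transferStep (α n) (z.1.1 - β (n + 1) - c - z.2) z.1.2))
        (by unfold transferStep; fun_prop)
    have h0 := h 0
    simp only [sub_zero] at h0
    exact (h0.add (h η)).div_const 2

theorem transferStep_smul (a x c : ℝ) (v : ℝ × ℝ) :
    transferStep a x (c • v) = c • transferStep a x v := by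
  simp only [transferStep, Prod.smul_mk, Prod.smul_fst, Prod.smul_snd, smul_eq_mul]
  ext <;> simp only <;> ring

theorem avgInvNorm_smul (E : ℝ) (n : ℕ) {c : ℝ} (hc : c ≠ 0) (v : ℝ × ℝ) :
    avgInvNorm α β η E n (c • v) = ENNReal.ofReal |c|⁻¹ * avgInvNorm α β η E n v := by
  induction n generalizing v with
  | zero =>
    simp only [avgInvNorm, invNorm, Prod.smul_fst, Prod.smul_snd, smul_eq_mul]
    rw [← ENNReal.ofReal_mul (by positivity), mul_pow, mul_pow, ← mul_add,
      Real.sqrt_mul (sq_nonneg c), Real.sqrt_sq_eq_abs]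
    congr 1
    rw [one_div, mul_inv, one_div]
  | succ n ih =>
    simp only [avgInvNorm, transferStep_smul, ih]
    rw [← unifAvg_const_mul]
    · congr 1
      ext s
      rw [← mul_add, mul_div_assoc]
    · have h : ∀ x : ℝ, Measurable (fun s : ℝ =>
          avgInvNorm α β η E n (transferStep (α n) (x - s) v)) :=
        fun x => (measurable_avgInvNorm α β η n).comp (f := fun s : ℝ =>
          (E, transferStep (α n) (x - s) v)) (by unfold transferStep; fun_prop)
      exact ((h _).add (h _)).div_const 2

/-- In the coordinate `y = p / q` the transfer step is `y ↦ a² / (x - y)`, and homogeneity of degree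
`-1` supplies exactly the weight occurring in `inversion`. -/
theorem avgInvNorm_transferStep {a : ℝ} (ha : 0 < a) (E x y : ℝ) (n : ℕ) (h : x - y ≠ 0) :
    avgInvNorm α β η E n (transferStep a x (y, 1))
      = ENNReal.ofReal (a / |x - y|) * avgInvNorm α β η E n (a ^ 2 / (x - y), 1) := by
  have e : transferStep a x (y, 1) = ((x - y) / a) • ((a ^ 2 / (x - y), 1) : ℝ × ℝ) := by
    have ha0 : a ≠ 0 := ha.ne'
    simp only [transferStep, Prod.smul_mk, smul_eq_mul, mul_one]
    ext
    · simp only; field_simp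
    · simp only
  rw [e, avgInvNorm_smul _ _ _ _ _ (div_ne_zero h ha.ne'), abs_div, inv_div, abs_of_pos ha]

/-- The averaged reciprocal norm as a real function of the projective coordinate. -/
noncomputable def avgProfile (E : ℝ) (n : ℕ) (y : ℝ) : ℝ := (avgInvNorm α β η E n (y, 1)).toReal

theorem measurable_avgProfile (E : ℝ) (n : ℕ) : Measurable (avgProfile α β η E n) :=
  ((measurable_avgInvNorm α β η n).comp (f := fun y : ℝ => (E, y, 1)) (by fun_prop)).ennreal_toReal

variable {α β η}

theorem ofReal_halfAvg_inversion {a : ℝ} (ha : 0 < a) (c : ℝ) {h : ℝ → ℝ} (hh : ∀ y, 0 ≤ h y)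
    (y : ℝ) : ENNReal.ofReal (halfAvg η c (inversion a h) y)
      = (ENNReal.ofReal (a / |c - y|) * ENNReal.ofReal (h (a ^ 2 / (c - y)))
        + ENNReal.ofReal (a / |c - η - y|) * ENNReal.ofReal (h (a ^ 2 / (c - η - y)))) / 2 := by
  have h1 := hh (a ^ 2 / (c - y))
  have h2 := hh (a ^ 2 / (c - η - y))
  simp only [halfAvg, inversion]
  rw [ENNReal.ofReal_div_of_pos two_pos, ENNReal.ofReal_add (by positivity) (by positivity),
    ENNReal.ofReal_mul (by positivity), ENNReal.ofReal_mul (by positivity), ENNReal.ofReal_ofNat]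

theorem avgProfile_nonneg (E : ℝ) (n : ℕ) (y : ℝ) : 0 ≤ avgProfile α β η E n y :=
  ENNReal.toReal_nonneg

/-- One random site amounts to an inversion, a coin average and an average over translations. The
two values of `s` for which the new vector leaves the chart `q ≠ 0` form a null set. -/
theorem avgInvNorm_succ (hα : ∀ k, 0 < α k) (E : ℝ) (n : ℕ)
    (hfin : ∀ y, avgInvNorm α β η E n (y, 1) ≠ ∞) (y : ℝ) :
    avgInvNorm α β η E (n + 1) (y, 1) = unifAvg η (fun s => ENNReal.ofReal
      (halfAvg η (E - β (n + 1)) (inversion (α n) (avgProfile α β η E n)) (y + s))) := by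
  rw [avgInvNorm]
  refine unifAvg_congr_ae η ?_
  have h1 : ∀ᵐ s : ℝ, s ≠ E - β (n + 1) - y := by simp [ae_iff]
  have h2 : ∀ᵐ s : ℝ, s ≠ E - β (n + 1) - η - y := by simp [ae_iff]
  filter_upwards [h1, h2] with s hs1 hs2
  rw [avgInvNorm_transferStep _ _ _ (hα n) _ _ _ _ (fun h => hs1 (by linarith)),
    avgInvNorm_transferStep _ _ _ (hα n) _ _ _ _ (fun h => hs2 (by linarith))]
  rw [ofReal_halfAvg_inversion (hα n) _ (avgProfile_nonneg E n)]
  simp only [avgProfile]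
  rw [ENNReal.ofReal_toReal (hfin _), ENNReal.ofReal_toReal (hfin _)]
  have e1 : E - β (n + 1) - s - y = E - β (n + 1) - (y + s) := by ring
  have e2 : E - β (n + 1) - η - s - y = E - β (n + 1) - η - (y + s) := by ring
  rw [e1, e2]

theorem halfAvg_inversion_nonneg {a : ℝ} (ha : 0 < a) (c : ℝ) {h : ℝ → ℝ} (hh : ∀ y, 0 ≤ h y)
    (y : ℝ) : 0 ≤ halfAvg η c (inversion a h) y := by
  have h1 := hh (a ^ 2 / (c - y))
  have h2 := hh (a ^ 2 / (c - η - y))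
  unfold halfAvg inversion
  positivity

/-- Cauchy–Schwarz against a bounded density: the uniform part of the law turns L² control into
pointwise control. -/
theorem unifAvg_sq_le_sqInt (hη : 0 < η) {g : ℝ → ℝ} (hg : Measurable g)
    (y : ℝ) : unifAvg η (fun s => ENNReal.ofReal (g (y + s))) ^ 2
      ≤ (ENNReal.ofReal η)⁻¹ * sqInt g := by
  refine (unifAvg_sq_le hη (by fun_prop)).trans ?_
  unfold unifAvg sqInt
  refine mul_le_mul_right ?_ _
  refine (setLIntegral_le_lintegral _ _).trans ?_
  rw [← lintegral_add_left_eq_self (fun x => ENNReal.ofReal (g x ^ 2)) y]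
  refine lintegral_mono fun s => ?_
  by_cases h0 : 0 ≤ g (y + s)
  · simp only
    rw [← ENNReal.ofReal_pow h0]
  · simp [ENNReal.ofReal_of_nonpos (not_le.1 h0).le]

theorem sqInt_avgProfile_zero_le (E : ℝ) :
    sqInt (avgProfile α β η E 0) ≤ ENNReal.ofReal Real.pi := by
  have h : ∀ y : ℝ, (avgProfile α β η E 0 y) ^ 2 = (1 + y ^ 2)⁻¹ := fun y => by
    simp only [avgProfile, avgInvNorm, invNorm]
    rw [ENNReal.toReal_ofReal (by positivity), div_pow, Real.sq_sqrt (by positivity)]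
    rw [one_pow, one_div, add_comm]
  unfold sqInt
  simp only [h]
  rw [← ofReal_integral_eq_lintegral_ofReal integrable_inv_one_add_sq
    (Filter.Eventually.of_forall fun y => by simp only [Pi.zero_apply]; positivity),
    integral_univ_inv_one_add_sq]

theorem avgInvNorm_succ_sq_le (hη : 0 < η) (hα : ∀ k, 0 < α k) (E : ℝ) (n : ℕ)
    (hfin : ∀ y, avgInvNorm α β η E n (y, 1) ≠ ∞) (y : ℝ) :
    avgInvNorm α β η E (n + 1) (y, 1) ^ 2
      ≤ (ENNReal.ofReal η)⁻¹ * sqInt (avgProfile α β η E n) := by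
  have hm := measurable_inversion (α n) (measurable_avgProfile α β η E n)
  rw [avgInvNorm_succ hα E n hfin]
  refine (unifAvg_sq_le_sqInt hη (measurable_halfAvg η _ hm) y).trans ?_
  gcongr
  exact (sqInt_halfAvg_le η _ hm).trans_eq (sqInt_inversion (hα n) _)

theorem ofReal_toReal_sq (x : ℝ≥0∞) : ENNReal.ofReal (x.toReal ^ 2) ≤ x ^ 2 := by
  rw [ENNReal.ofReal_pow ENNReal.toReal_nonneg]
  gcongr
  exact ENNReal.ofReal_toReal_le

theorem sqInt_avgProfile_succ_le (hη : 0 < η) (hα : ∀ k, 0 < α k) (E : ℝ) (n : ℕ)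
    (hfin : ∀ y, avgInvNorm α β η E n (y, 1) ≠ ∞) :
    sqInt (avgProfile α β η E (n + 1)) ≤ sqInt (avgProfile α β η E n) := by
  have hm := measurable_inversion (α n) (measurable_avgProfile α β η E n)
  set G := halfAvg η (E - β (n + 1)) (inversion (α n) (avgProfile α β η E n)) with hG
  have mG : Measurable G := measurable_halfAvg η _ hm
  calc sqInt (avgProfile α β η E (n + 1))
      ≤ ∫⁻ y, unifAvg η (fun s => ENNReal.ofReal (G (y + s) ^ 2)) := by
        refine lintegral_mono fun y => (ofReal_toReal_sq _).trans ?_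
        rw [avgInvNorm_succ hα E n hfin]
        refine (unifAvg_sq_le hη (mG.comp (by fun_prop)).ennreal_ofReal).trans
          (unifAvg_mono η fun s => ?_)
        simp only [Function.comp_apply]
        rw [← ENNReal.ofReal_pow (halfAvg_inversion_nonneg (hα n) _ (avgProfile_nonneg E n) _)]
    _ = unifAvg η (fun s => sqInt G) := by
        rw [lintegral_unifAvg _ η (by fun_prop)]
        congr 1
        ext s
        exact lintegral_add_right_eq_self (fun y => ENNReal.ofReal (G y ^ 2)) s
    _ = sqInt G := unifAvg_const hη _
    _ ≤ _ := (sqInt_halfAvg_le η _ hm).trans_eq (sqInt_inversion (hα n) _)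

/-- The uniform shift at the first site is absorbed into the constant `E - β (n + 1) - s`, and the
shift at the second site merely translates. By Jensen, a bound valid for each fixed pair of shifts
survives the averaging. -/
theorem sqInt_avgProfile_add_two_le (hη : 0 < η) (hα : ∀ k, 0 < α k) (E : ℝ) (n : ℕ)
    (hfin : ∀ y, avgInvNorm α β η E n (y, 1) ≠ ∞)
    (hfin' : ∀ y, avgInvNorm α β η E (n + 1) (y, 1) ≠ ∞) {R : ℝ≥0∞}
    (hR : ∀ s, sqInt (halfAvg η (E - β (n + 2)) (inversion (α (n + 1))
      (halfAvg η (E - β (n + 1) - s) (inversion (α n) (avgProfile α β η E n))))) ≤ R) :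
    sqInt (avgProfile α β η E (n + 2)) ≤ R := by
  have hm := measurable_inversion (α n) (measurable_avgProfile α β η E n)
  set H : ℝ → ℝ → ℝ := fun s => halfAvg η (E - β (n + 2)) (inversion (α (n + 1))
      (halfAvg η (E - β (n + 1) - s) (inversion (α n) (avgProfile α β η E n)))) with hH
  have mH : Measurable (fun z : ℝ × ℝ => H z.1 z.2) := by
    have mP := measurable_avgProfile α β η E n
    simp only [hH, halfAvg, inversion]
    fun_prop
  have hH0 : ∀ s y, 0 ≤ H s y := fun s y =>
    halfAvg_inversion_nonneg (hα _) _ (halfAvg_inversion_nonneg (hα n) _ (avgProfile_nonneg E n)) _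
  -- The second step is linear on nonnegative functions, hence commutes with the average over the
  -- first shift.
  have key : ∀ z, ENNReal.ofReal (halfAvg η (E - β (n + 2)) (inversion (α (n + 1))
      (avgProfile α β η E (n + 1))) z) = unifAvg η (fun s => ENNReal.ofReal (H s z)) := fun z => by
    have mG : ∀ y, Measurable (fun s => ENNReal.ofReal
        (halfAvg η (E - β (n + 1) - s) (inversion (α n) (avgProfile α β η E n)) y)) := fun y => by
      have mP := measurable_avgProfile α β η E n
      simp only [halfAvg, inversion]
      fun_prop
    have hprof : ∀ y, ENNReal.ofReal (avgProfile α β η E (n + 1) y)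
        = unifAvg η (fun s => ENNReal.ofReal
          (halfAvg η (E - β (n + 1) - s) (inversion (α n) (avgProfile α β η E n)) y)) := fun y => by
      rw [avgProfile, ENNReal.ofReal_toReal (hfin' _), avgInvNorm_succ hα E n hfin]
      congr 1
      ext s
      simp only [halfAvg]
      have e1 : E - β (n + 1) - (y + s) = E - β (n + 1) - s - y := by ring
      have e2 : E - β (n + 1) - η - (y + s) = E - β (n + 1) - s - η - y := by ring
      rw [e1, e2]
    rw [ofReal_halfAvg_inversion (hα _) _ (avgProfile_nonneg E _), hprof, hprof,
      ← unifAvg_const_mul _ _ (mG _), ← unifAvg_const_mul _ _ (mG _),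
      ← unifAvg_add _ ((mG _).const_mul _), ENNReal.div_eq_inv_mul,
      ← unifAvg_const_mul _ _ (Measurable.fun_add ((mG _).const_mul _) ((mG _).const_mul _))]
    congr 1
    ext s
    simp only [hH]
    rw [ofReal_halfAvg_inversion (hα _) _
      (halfAvg_inversion_nonneg (hα n) _ (avgProfile_nonneg E n)), ENNReal.div_eq_inv_mul]
  calc sqInt (avgProfile α β η E (n + 2))
      ≤ ∫⁻ y, unifAvg η (fun s' => unifAvg η (fun s => ENNReal.ofReal (H s (y + s') ^ 2))) := by
        refine lintegral_mono fun y => (ofReal_toReal_sq _).trans ?_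
        rw [avgInvNorm_succ hα E (n + 1) hfin']
        simp only [key]
        refine (unifAvg_sq_le hη ?_).trans (unifAvg_mono η fun s' =>
          (unifAvg_sq_le hη ?_).trans (unifAvg_mono η fun s => ?_))
        · exact measurable_unifAvg η (g := fun s' s => ENNReal.ofReal (H s (y + s')))
            (mH.comp (f := fun z : ℝ × ℝ => (z.2, y + z.1)) (by fun_prop)).ennreal_ofReal
        · exact (mH.comp (f := fun s : ℝ => (s, y + s')) (by fun_prop)).ennreal_ofReal
        · rw [← ENNReal.ofReal_pow (hH0 _ _)]
    _ = unifAvg η (fun s' => unifAvg η (fun s => sqInt (H s))) := by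
        rw [lintegral_unifAvg _ η]
        · congr 1
          ext s'
          rw [lintegral_unifAvg _ η]
          · congr 1
            ext s
            exact lintegral_add_right_eq_self (fun y => ENNReal.ofReal (H s y ^ 2)) s'
          · exact ((mH.comp (f := fun z : ℝ × ℝ => (z.2, z.1 + s'))
              (by fun_prop)).pow_const 2).ennreal_ofReal
        · exact measurable_unifAvg η (g := fun (z : ℝ × ℝ) s => ENNReal.ofReal (H s (z.1 + z.2) ^ 2))
            ((mH.comp (f := fun z : (ℝ × ℝ) × ℝ => (z.2, z.1.1 + z.1.2))
              (by fun_prop)).pow_const 2).ennreal_ofReal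
    _ ≤ unifAvg η (fun s' => unifAvg η (fun s => R)) :=
        unifAvg_mono η fun s' => unifAvg_mono η fun s => hR s
    _ = R := by rw [unifAvg_const hη, unifAvg_const hη]

end

/-- Finiteness is carried along in the induction because the profile is a `toReal`. A contraction by
`r` over two sites is the rate `√r` per site, and the factor `1 / √r` in `K` accounts for the step
from `0` to `1`, where the norm is only known not to grow. -/
theorem exists_sqInt_avgProfile_le {η : ℝ} (hη : 0 < η) (A : ℝ) :
    ∃ K κ : ℝ, 0 < K ∧ 0 < κ ∧ κ < 1 ∧ ∀ (α β : ℕ → ℝ) (E : ℝ), (∀ k, 0 < α k ∧ α k ≤ A) →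
      ∀ n, (∀ y, avgInvNorm α β η E n (y, 1) ≠ ∞) ∧
        sqInt (avgProfile α β η E n) ≤ ENNReal.ofReal (K * κ ^ n) := by
  obtain ⟨ρ, hρ1, hρ⟩ := exists_contraction hη A
  -- The floor `1 / 2` keeps the rate positive, so that division by `√r` and logarithms make sense.
  set r : ℝ := max ρ.toReal (1 / 2) with hr
  have hr0 : 0 < r := lt_max_of_lt_right (by norm_num)
  have hr1 : r < 1 := by
    refine max_lt ?_ (by norm_num)
    rw [← ENNReal.toReal_one]
    exact ENNReal.toReal_strict_mono ENNReal.one_ne_top hρ1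
  have hρr : ρ ≤ ENNReal.ofReal r := by
    rw [← ENNReal.ofReal_toReal (ne_top_of_lt hρ1)]
    exact ENNReal.ofReal_le_ofReal (le_max_left _ _)
  have hκ0 : 0 < √r := Real.sqrt_pos.2 hr0
  have hκ2 : √r ^ 2 = r := Real.sq_sqrt hr0.le
  have hκ1 : √r < 1 := by
    rw [Real.sqrt_lt' one_pos]
    simpa using hr1
  refine ⟨Real.pi / √r, √r, by positivity, hκ0, hκ1, fun α β E hα n => ?_⟩
  have hα0 : ∀ k, 0 < α k := fun k => (hα k).1
  have fin_step : ∀ n, (∀ y, avgInvNorm α β η E n (y, 1) ≠ ∞) →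
      sqInt (avgProfile α β η E n) ≠ ∞ → ∀ y, avgInvNorm α β η E (n + 1) (y, 1) ≠ ∞ := by
    intro n h1 h2 y htop
    have := avgInvNorm_succ_sq_le hη hα0 E n h1 y
    rw [htop, ENNReal.top_pow two_ne_zero, top_le_iff] at this
    exact ENNReal.mul_ne_top (ENNReal.inv_ne_top.2 (by simpa using hη)) h2 this
  have h0 : ∀ y, avgInvNorm α β η E 0 (y, 1) ≠ ∞ := fun y => ENNReal.ofReal_ne_top
  have s0 : sqInt (avgProfile α β η E 0) ≤ ENNReal.ofReal (Real.pi / √r * √r ^ 0) :=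
    (sqInt_avgProfile_zero_le E).trans (ENNReal.ofReal_le_ofReal (by
      rw [pow_zero, mul_one]
      exact le_div_self Real.pi_pos.le hκ0 hκ1.le))
  induction n using Nat.twoStepInduction with
  | zero => exact ⟨h0, s0⟩
  | one =>
    refine ⟨fin_step 0 h0 (ne_top_of_le_ne_top ENNReal.ofReal_ne_top s0), ?_⟩
    refine (sqInt_avgProfile_succ_le hη hα0 E 0 h0).trans ((sqInt_avgProfile_zero_le E).trans ?_)
    refine ENNReal.ofReal_le_ofReal ?_
    rw [pow_one, div_mul_cancel₀ _ hκ0.ne']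
  | more n ih1 ih2 =>
    have f1 : sqInt (avgProfile α β η E n) ≠ ∞ := ne_top_of_le_ne_top ENNReal.ofReal_ne_top ih1.2
    have f2 := ne_top_of_le_ne_top ENNReal.ofReal_ne_top ih2.2
    refine ⟨fin_step (n + 1) ih2.1 f2, ?_⟩
    refine (sqInt_avgProfile_add_two_le hη hα0 E n ih1.1 ih2.1 (fun s =>
      hρ _ _ _ _ _ (hα0 _) (hα0 _) (hα _).2 (measurable_avgProfile α β η E n) f1)).trans ?_
    refine (mul_le_mul' hρr ih1.2).trans ?_
    rw [← ENNReal.ofReal_mul hr0.le]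
    refine ENNReal.ofReal_le_ofReal (le_of_eq ?_)
    rw [pow_add, hκ2]
    ring

/-- Homogeneity reduces to `v.2 = 1`, which is why the factor `|v.2|` yields uniformity in `v`. The
site `n + 1` is spent on passing from L² to a pointwise bound. -/
theorem exists_avgInvNorm_le {η : ℝ} (hη : 0 < η) (A : ℝ) :
    ∃ C r : ℝ, 0 < C ∧ 0 < r ∧ r < 1 ∧ ∀ (α β : ℕ → ℝ) (E : ℝ), (∀ k, 0 < α k ∧ α k ≤ A) →
      ∀ n v, ENNReal.ofReal |v.2| * avgInvNorm α β η E (n + 1) v ≤ ENNReal.ofReal (C * r ^ n) := by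
  obtain ⟨K, κ, hK, hκ0, hκ1, h⟩ := exists_sqInt_avgProfile_le hη A
  refine ⟨√(K / η), √κ, by positivity, by positivity, ?_, fun α β E hα n v => ?_⟩
  · rw [Real.sqrt_lt' one_pos]
    simpa using hκ1
  obtain ⟨p, q⟩ := v
  simp only
  rcases eq_or_ne q 0 with rfl | hq
  · simp
  have e : ((p, q) : ℝ × ℝ) = q • (p / q, 1) := by
    simp only [Prod.smul_mk, smul_eq_mul, mul_one]
    rw [mul_div_cancel₀ _ hq]
  rw [e, avgInvNorm_smul _ _ _ _ _ hq, ← mul_assoc, ← ENNReal.ofReal_mul (abs_nonneg _),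
    mul_inv_cancel₀ (abs_ne_zero.2 hq), ENNReal.ofReal_one, one_mul]
  obtain ⟨h1, h2⟩ := h α β E hα n
  have h3 := avgInvNorm_succ_sq_le hη (fun k => (hα k).1) E n h1 (p / q)
  refine (ENNReal.pow_le_pow_left_iff two_ne_zero).1 ?_
  refine h3.trans ((mul_le_mul_right h2 _).trans ?_)
  rw [← ENNReal.ofReal_inv_of_pos hη, ← ENNReal.ofReal_mul (by positivity),
    ← ENNReal.ofReal_pow (by positivity)]
  refine ENNReal.ofReal_le_ofReal (le_of_eq ?_)
  rw [mul_pow, Real.sq_sqrt (by positivity), ← pow_mul, mul_comm n 2, pow_mul,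
    Real.sq_sqrt hκ0.le]
  field_simp

/-! ### Half-line solutions and the deterministic choice of the potential -/

/-- The states of a half-line Jacobi recursion started from `v` at the site `n` and run down to the
site `0`: the state at `k` is `(α k * u (k + 1), u k)`. -/
noncomputable def halfLineState (α b : ℕ → ℝ) (E : ℝ) : ℕ → ℝ × ℝ → ℕ → ℝ × ℝ
  | 0, v, _ => v
  | n + 1, v, k =>
      if k = n + 1 then v else halfLineState α b E n (transferStep (α n) (E - b (n + 1)) v) k

theorem halfLineState_self (α b : ℕ → ℝ) (E : ℝ) (n : ℕ) (v : ℝ × ℝ) :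
    halfLineState α b E n v n = v := by
  cases n <;> simp [halfLineState]

theorem halfLineState_of_lt (α b : ℕ → ℝ) (E : ℝ) {n k : ℕ} (h : k < n) (v : ℝ × ℝ) :
    halfLineState α b E n v k
      = transferStep (α k) (E - b (k + 1)) (halfLineState α b E n v (k + 1)) := by
  induction n generalizing v with
  | zero => omega
  | succ n ih =>
    rcases Nat.lt_succ_iff_lt_or_eq.1 h with h | rfl
    · simp only [halfLineState]
      rw [if_neg (by omega), if_neg (by omega), ih h]
    · simp only [halfLineState]
      rw [if_neg (by omega), halfLineState_self, if_pos trivial]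

theorem halfLineState_congr {α b b' : ℕ → ℝ} (E : ℝ) {n : ℕ}
    (h : ∀ k, 1 ≤ k → k ≤ n → b k = b' k) (v : ℝ × ℝ) (k : ℕ) : halfLineState α b E n v k = halfLineState α b' E n v k := by
  induction n generalizing v with
  | zero => rfl
  | succ n ih =>
    simp only [halfLineState]
    rw [h _ (by omega) le_rfl, ih fun j hj hj' => h j hj (by omega)]

theorem continuous_halfLineState (α b : ℕ → ℝ) (n : ℕ) {v : ℝ → ℝ × ℝ} (hv : Continuous v)
    (k : ℕ) : Continuous (fun E => halfLineState α b E n (v E) k) := by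
  induction n generalizing v with
  | zero => exact hv
  | succ n ih =>
    simp only [halfLineState]
    split_ifs
    · exact hv
    · exact ih (v := fun E => transferStep (α n) (E - b (n + 1)) (v E))
        (by unfold transferStep; fun_prop)

theorem transferStep_ne_zero {a : ℝ} (ha : a ≠ 0) (x : ℝ) {v : ℝ × ℝ} (hv : v ≠ 0) :
    transferStep a x v ≠ 0 := by
  intro h
  have h1 : a * v.2 = 0 := congrArg Prod.fst h
  have h2 : (x * v.2 - v.1) / a = 0 := congrArg Prod.snd h
  have h3 : v.2 = 0 := (mul_eq_zero.1 h1).resolve_left ha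
  rw [h3] at h2
  have h4 : v.1 = 0 := by
    have := (div_eq_zero_iff.1 h2).resolve_right ha
    linarith
  exact hv (Prod.ext h4 h3)

theorem halfLineState_ne_zero {α : ℕ → ℝ} (hα : ∀ k, α k ≠ 0) (b : ℕ → ℝ) (E : ℝ) (n : ℕ)
    {v : ℝ × ℝ} (hv : v ≠ 0) (k : ℕ) : halfLineState α b E n v k ≠ 0 := by
  induction n generalizing v with
  | zero => exact hv
  | succ n ih =>
    simp only [halfLineState]
    split_ifs
    · exact hv
    · exact ih (transferStep_ne_zero (hα _) _ hv)

/-- Method of conditional expectations: from the site `n` downwards, each value of the potential is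
fixed so that the remaining mean does not exceed its average. The weight `W` collects the terms of
sites already passed, which later choices no longer affect. A single choice serves all energies
since it is the integral over `E` that is averaged. -/
theorem exists_potential {α β : ℕ → ℝ} {η : ℝ} (hη : 0 < η) {ν : Measure ℝ} [SFinite ν]
    (c B : ℕ → ℝ≥0∞)
    (hB : ∀ E n v, ENNReal.ofReal |v.2| * avgInvNorm α β η E (n + 1) v ≤ B (n + 1)) (n : ℕ) :
    ∀ (W : ℝ → ℝ≥0∞) (v : ℝ → ℝ × ℝ), Measurable W → Continuous v →
      ∃ b : ℕ → ℝ, (∀ k, β k ≤ b k ∧ b k ≤ β k + 2 * η) ∧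
        ∫⁻ E, (W E + ∑ m ∈ Finset.Icc 1 n,
            c m * ENNReal.ofReal |(halfLineState α b E n (v E) m).2|)
          * invNorm (halfLineState α b E n (v E) 0) ∂ν
        ≤ ∫⁻ E, W E * avgInvNorm α β η E n (v E) ∂ν
          + ∑ m ∈ Finset.Icc 1 n, c m * B m * ν Set.univ := by
  induction n with
  | zero =>
    intro W v _ _
    refine ⟨β, fun k => ⟨le_rfl, by linarith⟩, ?_⟩
    simp [halfLineState, avgInvNorm]
  | succ n ih =>
    intro W v hW hv
    set W' : ℝ → ℝ≥0∞ := fun E => W E + c (n + 1) * ENNReal.ofReal |(v E).2| with hW'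
    have mW' : Measurable W' := by
      have := hv.measurable
      fun_prop
    have mI : Measurable (fun z : ℝ × ℝ => W' z.1 *
        avgInvNorm α β η z.1 n (transferStep (α n) (z.1 - β (n + 1) - z.2) (v z.1))) := by
      have mv := hv.measurable
      refine (mW'.comp measurable_fst).mul ?_
      exact (measurable_avgInvNorm α β η n).comp (f := fun z : ℝ × ℝ =>
        (z.1, transferStep (α n) (z.1 - β (n + 1) - z.2) (v z.1)))
        (by unfold transferStep; fun_prop)
    set I : ℝ → ℝ≥0∞ := fun ω => ∫⁻ E, W' E *
        avgInvNorm α β η E n (transferStep (α n) (E - β (n + 1) - ω) (v E)) ∂ν with hI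
    have mI' : Measurable I := Measurable.lintegral_prod_left' mI
    have havg : ∫⁻ E, W' E * avgInvNorm α β η E (n + 1) (v E) ∂ν
        = unifAvg η (fun s => (I s + I (η + s)) / 2) := by
      have mJ : ∀ t : ℝ, Measurable (fun z : ℝ × ℝ => W' z.1 *
          avgInvNorm α β η z.1 n (transferStep (α n) (z.1 - β (n + 1) - (t + z.2)) (v z.1))) :=
        fun t => mI.comp (f := fun z : ℝ × ℝ => (z.1, t + z.2)) (by fun_prop)
      have mJ0 := mJ 0
      simp only [zero_add] at mJ0
      have hpt : ∀ E, W' E * avgInvNorm α β η E (n + 1) (v E) = unifAvg η (fun s =>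
          (W' E * avgInvNorm α β η E n (transferStep (α n) (E - β (n + 1) - s) (v E))
          + W' E * avgInvNorm α β η E n
            (transferStep (α n) (E - β (n + 1) - (η + s)) (v E))) / 2) := fun E => by
        have mA : ∀ t : ℝ, Measurable (fun s => avgInvNorm α β η E n
            (transferStep (α n) (E - β (n + 1) - t - s) (v E))) := fun t =>
          (measurable_avgInvNorm α β η n).comp (f := fun s : ℝ =>
            (E, transferStep (α n) (E - β (n + 1) - t - s) (v E)))
            (by unfold transferStep; fun_prop)
        have mA0 := mA 0
        simp only [sub_zero] at mA0
        rw [avgInvNorm, ← unifAvg_const_mul _ _ ((mA0.fun_add (mA η)).div_const 2)]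
        congr 1
        ext s
        rw [← mul_add, mul_div_assoc, ← sub_sub]
      simp only [hpt]
      rw [lintegral_unifAvg ν η ((mJ0.add (mJ η)).div_const 2)]
      congr 1
      ext s
      simp only [ENNReal.div_eq_inv_mul]
      have mz : ∀ t : ℝ, Measurable (fun E => W' E *
          avgInvNorm α β η E n (transferStep (α n) (E - β (n + 1) - t) (v E))) :=
        fun t => mI.comp (f := fun E : ℝ => (E, t)) (by fun_prop)
      rw [lintegral_const_mul _ ((mz _).fun_add (mz _)), lintegral_add_left (mz _)]
    obtain ⟨s, hs, hle⟩ := exists_le_unifAvg hη (g := fun s => (I s + I (η + s)) / 2)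
      (by fun_prop)
    rw [← havg] at hle
    -- One of the two outcomes of the coin does no worse than their mean.
    obtain ⟨ω, hω0, hω2, hωle⟩ : ∃ ω : ℝ, 0 ≤ ω ∧ ω ≤ 2 * η ∧
        I ω ≤ ∫⁻ E, W' E * avgInvNorm α β η E (n + 1) (v E) ∂ν := by
      rcases le_total (I s) (I (η + s)) with h | h
      · refine ⟨s, hs.1, by linarith [hs.2], le_trans ?_ hle⟩
        rw [ENNReal.le_div_iff_mul_le (by simp) (by simp), mul_two]
        gcongr
      · refine ⟨η + s, by linarith [hs.1], by linarith [hs.2], le_trans ?_ hle⟩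
        rw [ENNReal.le_div_iff_mul_le (by simp) (by simp), mul_two]
        gcongr
    obtain ⟨b, hb, hbI⟩ := ih W' (fun E => transferStep (α n) (E - β (n + 1) - ω) (v E)) mW'
      (by unfold transferStep; fun_prop)
    refine ⟨Function.update b (n + 1) (β (n + 1) + ω), fun k => ?_, ?_⟩
    · rcases eq_or_ne k (n + 1) with rfl | hk
      · rw [Function.update_self]
        constructor <;> linarith
      · rw [Function.update_of_ne hk]
        exact hb k
    · have hst : ∀ E k, k ≤ n →
          halfLineState α (Function.update b (n + 1) (β (n + 1) + ω)) E (n + 1) (v E) k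
          = halfLineState α b E n (transferStep (α n) (E - β (n + 1) - ω) (v E)) k := by
        intro E k hk
        rw [halfLineState, if_neg (by omega), Function.update_self, ← sub_sub]
        exact halfLineState_congr E (fun j _ hj => by rw [Function.update_of_ne (by omega)]) _ _
      calc _ = ∫⁻ E, (W' E + ∑ m ∈ Finset.Icc 1 n, c m * ENNReal.ofReal
              |(halfLineState α b E n (transferStep (α n) (E - β (n + 1) - ω) (v E)) m).2|)
            * invNorm (halfLineState α b E n (transferStep (α n) (E - β (n + 1) - ω) (v E)) 0)
              ∂ν := by
            refine lintegral_congr fun E => ?_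
            rw [hst E 0 (Nat.zero_le n), Finset.sum_Icc_succ_top (by omega), halfLineState_self,
              Finset.sum_congr rfl fun m hm => by rw [hst E m (Finset.mem_Icc.1 hm).2]]
            simp only [hW']
            ring
        _ ≤ I ω + ∑ m ∈ Finset.Icc 1 n, c m * B m * ν Set.univ := hbI
        _ ≤ ∫⁻ E, W' E * avgInvNorm α β η E (n + 1) (v E) ∂ν
            + ∑ m ∈ Finset.Icc 1 n, c m * B m * ν Set.univ := by gcongr
        _ ≤ (∫⁻ E, W E * avgInvNorm α β η E (n + 1) (v E) ∂ν + c (n + 1) * B (n + 1) * ν Set.univ)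
            + ∑ m ∈ Finset.Icc 1 n, c m * B m * ν Set.univ := by
            gcongr
            simp only [hW', add_mul]
            rw [lintegral_add_left]
            · gcongr
              rw [← lintegral_const]
              refine lintegral_mono fun E => ?_
              simp only
              rw [mul_assoc]
              gcongr
              exact hB _ _ _
            · exact hW.mul ((measurable_avgInvNorm α β η (n + 1)).comp
                (f := fun E => (E, v E)) (measurable_id.prodMk hv.measurable))
        _ = _ := by
            rw [Finset.sum_Icc_succ_top (by omega), add_assoc, add_comm (c (n + 1) * _ * _)]

/-- The exponentially weighted sum of `|u m|` over the sites `1, …, L`, relative to the size of the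
state at the site `0`, for the half-line solution `u` that vanishes beyond `L`. -/
noncomputable def halfLineSum (γ : ℝ) (α b : ℕ → ℝ) (L : ℕ) (E : ℝ) : ℝ :=
  (∑ m ∈ Finset.Icc 1 L, Real.exp (γ * m) * |(halfLineState α b E L (0, 1) m).2|)
    / √((halfLineState α b E L (0, 1) 0).1 ^ 2 + (halfLineState α b E L (0, 1) 0).2 ^ 2)

theorem halfLineSum_nonneg (γ : ℝ) (α b : ℕ → ℝ) (L : ℕ) (E : ℝ) :
    0 ≤ halfLineSum γ α b L E := by
  unfold halfLineSum
  positivity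

theorem halfLineSum_congr (γ : ℝ) {α b b' : ℕ → ℝ} {L : ℕ}
    (h : ∀ k, 1 ≤ k → k ≤ L → b k = b' k) (E : ℝ) :
    halfLineSum γ α b L E = halfLineSum γ α b' L E := by
  unfold halfLineSum
  simp only [halfLineState_congr E h]

theorem sq_add_sq_pos_of_ne_zero {v : ℝ × ℝ} (hv : v ≠ 0) : 0 < v.1 ^ 2 + v.2 ^ 2 := by
  by_contra h
  have h1 : v.1 = 0 := by nlinarith [sq_nonneg v.1, sq_nonneg v.2]
  have h2 : v.2 = 0 := by nlinarith [sq_nonneg v.1, sq_nonneg v.2]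
  exact hv (Prod.ext h1 h2)

theorem continuous_halfLineSum (γ : ℝ) {α : ℕ → ℝ} (hα : ∀ k, α k ≠ 0) (b : ℕ → ℝ) (L : ℕ) :
    Continuous (halfLineSum γ α b L) := by
  have hc := continuous_halfLineState α b L (v := fun _ => (0, 1)) continuous_const
  unfold halfLineSum
  refine Continuous.div (by fun_prop) (by fun_prop) fun E => ?_
  exact (Real.sqrt_pos.2 (sq_add_sq_pos_of_ne_zero
    (halfLineState_ne_zero hα b E L (v := (0, 1)) (by simp) 0))).ne'

/-- Uniform exponential decay on half lines: for any bounded couplings and any background potential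
there is a perturbation of the potential of size at most `2η` for which the weighted sum of the
half-line solution has an energy integral bounded independently of the length. -/
theorem exists_halfLineSum_integral_le {η : ℝ} (hη : 0 < η) (A : ℝ) {M : ℝ} (hM : 0 ≤ M) :
    ∃ C γ : ℝ, 0 < γ ∧ ∀ (α β : ℕ → ℝ) (L : ℕ), (∀ k, 0 < α k ∧ α k ≤ A) →
      ∃ b : ℕ → ℝ, (∀ k, β k ≤ b k ∧ b k ≤ β k + 2 * η) ∧
        ∫ E in (-M)..M, halfLineSum γ α b L E ≤ C := by
  obtain ⟨C, r, hC, hr0, hr1, h⟩ := exists_avgInvNorm_le hη A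
  set q := √r with hq
  have hq0 : 0 < q := Real.sqrt_pos.2 hr0
  have hq2 : q ^ 2 = r := Real.sq_sqrt hr0.le
  have hq1 : q < 1 := by
    rw [hq, Real.sqrt_lt' one_pos]
    simpa using hr1
  -- Half of the available rate is given away: with `γ = -log √r` the terms `exp (γ m) * r ^ (m -
  -- 1)` equal `√r ^ m / r` and form a geometric series.
  refine ⟨C / r * (1 - q)⁻¹ * (2 * M), -Real.log q, neg_pos.2 (Real.log_neg hq0 hq1),
    fun α β L hα => ?_⟩
  set γ := -Real.log q with hγ
  have hexp : ∀ m : ℕ, Real.exp (γ * m) = (q⁻¹) ^ m := fun m => by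
    rw [mul_comm, Real.exp_nat_mul, hγ, Real.exp_neg, Real.exp_log hq0]
  obtain ⟨b, hb, hle⟩ := exists_potential (α := α) (β := β) hη
    (ν := volume.restrict (Set.Icc (-M) M))
    (fun m => ENNReal.ofReal (Real.exp (γ * m))) (fun m => ENNReal.ofReal (C * r ^ (m - 1)))
    (fun E n v => h α β E hα n v) L (fun _ => 0) (fun _ => (0, 1)) measurable_const
    continuous_const
  refine ⟨b, hb, ?_⟩
  have hcont := continuous_halfLineSum γ (fun k => (hα k).1.ne') b L
  simp only [zero_add, zero_mul, lintegral_zero] at hle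
  have e1 : ∀ E, (∑ m ∈ Finset.Icc 1 L, ENNReal.ofReal (Real.exp (γ * m))
      * ENNReal.ofReal |(halfLineState α b E L (0, 1) m).2|)
      * invNorm (halfLineState α b E L (0, 1) 0) = ENNReal.ofReal (halfLineSum γ α b L E) := by
    intro E
    unfold halfLineSum invNorm
    rw [div_eq_mul_one_div (∑ m ∈ _, _), ENNReal.ofReal_mul (by positivity),
      ENNReal.ofReal_sum_of_nonneg fun m _ => by positivity]
    congr 1
    exact Finset.sum_congr rfl fun m _ => (ENNReal.ofReal_mul (by positivity)).symm
  simp only [e1] at hle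
  rw [intervalIntegral.integral_of_le (by linarith), ← integral_Icc_eq_integral_Ioc,
    integral_eq_lintegral_of_nonneg_ae
      (Filter.Eventually.of_forall fun E => halfLineSum_nonneg γ α b L E)
      hcont.aestronglyMeasurable]
  refine ENNReal.toReal_le_of_le_ofReal ?_ (hle.trans ?_)
  · have : 0 < 1 - q := by linarith
    positivity
  · have e2 : ∀ m ∈ Finset.Icc 1 L, ENNReal.ofReal (Real.exp (γ * m))
        * ENNReal.ofReal (C * r ^ (m - 1)) * (volume.restrict (Set.Icc (-M) M)) Set.univ
        = ENNReal.ofReal (C / r * q ^ m * (2 * M)) := by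
      intro m hm
      obtain ⟨k, rfl⟩ : ∃ k, m = k + 1 := ⟨m - 1, by have := (Finset.mem_Icc.1 hm).1; omega⟩
      rw [Measure.restrict_apply_univ, Real.volume_Icc, ← ENNReal.ofReal_mul (by positivity),
        ← ENNReal.ofReal_mul (by positivity), hexp]
      congr 1
      rw [Nat.add_sub_cancel, ← hq2, inv_pow]
      field_simp
      ring
    rw [Finset.sum_congr rfl e2, ← ENNReal.ofReal_sum_of_nonneg fun m _ => by positivity,
      ← Finset.sum_mul, ← Finset.mul_sum]
    refine ENNReal.ofReal_le_ofReal ?_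
    gcongr
    rw [← tsum_geometric_of_lt_one hq0.le hq1]
    exact (summable_geometric_of_lt_one hq0.le hq1).sum_le_tsum _ fun m _ => by positivity

/-! ### Spectral averaging for rank-two perturbations in finite dimension -/

section FiniteDimensional

variable {V : Type*} [NormedAddCommGroup V] [InnerProductSpace ℝ V]

/-- The trace of endomorphisms of a finite-dimensional space, as a continuous linear functional. -/
noncomputable def traceCLM (V : Type*) [NormedAddCommGroup V] [InnerProductSpace ℝ V]
    [FiniteDimensional ℝ V] : (V →L[ℝ] V) →L[ℝ] ℝ :=
  LinearMap.toContinuousLinearMap (LinearMap.trace ℝ V ∘ₗ ContinuousLinearMap.coeLM ℝ)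

theorem traceCLM_mul_comm [FiniteDimensional ℝ V] (S T : V →L[ℝ] V) : traceCLM V (S * T) = traceCLM V (T * S) :=
  LinearMap.trace_mul_comm ℝ (S : V →ₗ[ℝ] V) (T : V →ₗ[ℝ] V)

theorem traceCLM_eq_sum [FiniteDimensional ℝ V] {ι : Type*} [Fintype ι] (u : OrthonormalBasis ι ℝ V) (T : V →L[ℝ] V) :
    traceCLM V T = ∑ k, inner ℝ (u k) (T (u k)) :=
  LinearMap.trace_eq_sum_inner (T : V →ₗ[ℝ] V) u

/-- Under the trace, cyclicity brings `P` to the front of every term of the noncommutative product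
rule, so the scalar formula survives. -/
theorem hasDerivAt_traceCLM_aeval [FiniteDimensional ℝ V] (T P : V →L[ℝ] V) (Φ : Polynomial ℝ) (t : ℝ) :
    HasDerivAt (fun t : ℝ => traceCLM V (Polynomial.aeval (T + t • P) Φ))
      (traceCLM V (P * Polynomial.aeval (T + t • P) (Polynomial.derivative Φ))) t := by
  induction Φ using Polynomial.induction_on' with
  | add p q hp hq =>
    simp only [map_add, mul_add]
    exact hp.add hq
  | monomial n c =>
    have h1 : HasDerivAt (fun t : ℝ => T + t • P) P t := by
      simpa using ((hasDerivAt_id t).smul_const P).const_add T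
    have h2 : HasDerivAt (fun t : ℝ => traceCLM V (c • (T + t • P) ^ n))
        (traceCLM V (c • ∑ i ∈ Finset.range n,
          (T + t • P) ^ (n.pred - i) * P * (T + t • P) ^ i)) t :=
      (traceCLM V).hasFDerivAt.comp_hasDerivAt t ((h1.fun_pow' n).fun_const_smul c)
    simp only [Polynomial.derivative_monomial, Polynomial.aeval_monomial, ← Algebra.smul_def]
    refine h2.congr_deriv ?_
    simp only [map_smul, map_sum, smul_eq_mul, mul_smul_comm]
    rw [mul_assoc]
    congr 1
    rw [Finset.sum_congr rfl (g := fun _ => traceCLM V (P * (T + t • P) ^ (n - 1)))]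
    · simp
    · intro i hi
      rw [traceCLM_mul_comm, ← mul_assoc, ← pow_add, traceCLM_mul_comm, Nat.pred_eq_sub_one]
      congr 3
      have := Finset.mem_range.1 hi
      omega

theorem aeval_apply_eigenvector {T : V →L[ℝ] V} {x : V} {l : ℝ} (h : T x = l • x)
    (Φ : Polynomial ℝ) : Polynomial.aeval T Φ x = Φ.eval l • x := by
  induction Φ using Polynomial.induction_on' with
  | add p q hp hq => rw [map_add, add_apply, hp, hq, Polynomial.eval_add, add_smul]
  | monomial n c =>
    have hp : ∀ n : ℕ, (T ^ n) x = l ^ n • x := fun n => by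
      induction n with
      | zero => simp
      | succ n ih => rw [pow_succ, mul_apply_eq_comp, h, map_smul, ih, smul_smul,
          pow_succ, mul_comm]
    rw [Polynomial.aeval_monomial, ← Algebra.smul_def, smul_apply, hp,
      Polynomial.eval_monomial, smul_smul]

variable {ι κ : Type*} [Fintype ι] [Fintype κ]

theorem sum_sub_mul_inner_sq {S : V →L[ℝ] V} (u : OrthonormalBasis ι ℝ V) {l : ι → ℝ}
    (hS : ∀ k, S (u k) = l k • u k) (E : ℝ) (x : V) :
    ∑ k, (l k - E) * inner ℝ (u k) x ^ 2 = inner ℝ x (S x) - E * inner ℝ x x := by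
  have h1 : inner ℝ x (S x) = ∑ k, l k * inner ℝ (u k) x ^ 2 := by
    conv_lhs => rw [← u.sum_repr' x, map_sum, inner_sum]
    refine Finset.sum_congr rfl fun k _ => ?_
    rw [map_smul, hS, inner_smul_right, inner_smul_right, u.sum_repr', real_inner_comm]
    ring
  have h2 : inner ℝ x x = ∑ k, inner ℝ (u k) x ^ 2 := by
    conv_lhs => rw [← u.sum_inner_mul_inner x x]
    exact Finset.sum_congr rfl fun k _ => by rw [real_inner_comm, sq]
  rw [h1, h2, Finset.mul_sum, ← Finset.sum_sub_distrib]
  exact Finset.sum_congr rfl fun k _ => by ring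

open Classical in
/-- Two self-adjoint operators whose quadratic forms agree on the common kernel of two functionals
have eigenvalue counting functions that differ by at most two. -/
theorem card_eigenvalues_le {S S' : V →L[ℝ] V} (u : OrthonormalBasis ι ℝ V)
    (u' : OrthonormalBasis κ ℝ V) {l : ι → ℝ} {l' : κ → ℝ} (hS : ∀ k, S (u k) = l k • u k)
    (hS' : ∀ k, S' (u' k) = l' k • u' k) (e₁ e₂ : V)
    (h : ∀ x, inner ℝ e₁ x = 0 → inner ℝ e₂ x = 0 → inner ℝ x (S x) = inner ℝ x (S' x)) (E : ℝ) :
    (Finset.univ.filter fun k => E ≤ l' k).card ≤ (Finset.univ.filter fun k => E ≤ l k).card + 2 := by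
  by_contra hlt
  rw [not_le] at hlt
  let X : ({k // E ≤ l' k} → ℝ) →ₗ[ℝ] V := Fintype.linearCombination ℝ (fun k => u' k.1)
  let Λ : V →ₗ[ℝ] ({k // E ≤ l k} → ℝ) × ℝ × ℝ :=
    (LinearMap.pi fun k => (innerSL ℝ (u k.1)).toLinearMap).prod
      ((innerSL ℝ e₁).toLinearMap.prod (innerSL ℝ e₂).toLinearMap)
  -- By counting dimensions, some nonzero combination of the eigenvectors of `S'` with `E ≤ l'` is
  -- orthogonal to `e₁`, `e₂` and all eigenvectors of `S` with `E ≤ l`. On it the form of `S' - E`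
  -- is nonnegative and that of `S - E` is negative, although the two agree.
  have hker : LinearMap.ker (Λ ∘ₗ X) ≠ ⊥ := by
    apply LinearMap.ker_ne_bot_of_finrank_lt
    simp only [Module.finrank_prod, Module.finrank_fintype_fun_eq_card, Module.finrank_self,
      Fintype.card_subtype]
    omega
  obtain ⟨d, hd, hd0⟩ := Submodule.exists_mem_ne_zero_of_ne_bot hker
  set x := X d with hx
  have hΛ : Λ x = 0 := hd
  have hx1 : ∀ k, E ≤ l k → inner ℝ (u k) x = 0 := fun k hk =>
    congrFun (congrArg Prod.fst hΛ) ⟨k, hk⟩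
  have hx2 : inner ℝ e₁ x = 0 := congrArg (fun z => z.2.1) hΛ
  have hx3 : inner ℝ e₂ x = 0 := congrArg (fun z => z.2.2) hΛ
  have hxd : ∀ k : {k // E ≤ l' k}, inner ℝ (u' k.1) x = d k := fun k => by
    rw [hx]
    simp only [X, Fintype.linearCombination_apply, inner_sum, inner_smul_right,
      orthonormal_iff_ite.1 u'.orthonormal]
    rw [Finset.sum_eq_single k]
    · simp
    · intro j _ hj
      rw [if_neg (fun h => hj (Subtype.ext h.symm)), mul_zero]
    · simp
  have hxd0 : ∀ k, ¬ E ≤ l' k → inner ℝ (u' k) x = 0 := fun k hk => by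
    rw [hx]
    simp only [X, Fintype.linearCombination_apply, inner_sum, inner_smul_right,
      orthonormal_iff_ite.1 u'.orthonormal]
    refine Finset.sum_eq_zero fun j _ => ?_
    rw [if_neg (fun h : k = j.1 => hk (h ▸ j.2)), mul_zero]
  have s1 := sum_sub_mul_inner_sq u hS E x
  have s2 := sum_sub_mul_inner_sq u' hS' E x
  rw [h x hx2 hx3, ← s2] at s1
  have p2 : 0 ≤ ∑ k, (l' k - E) * inner ℝ (u' k) x ^ 2 := Finset.sum_nonneg fun k _ => by
    by_cases hk : E ≤ l' k
    · exact mul_nonneg (sub_nonneg.2 hk) (sq_nonneg _)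
    · rw [hxd0 k hk]
      simp
  have p1 : ∀ k ∈ Finset.univ, (l k - E) * inner ℝ (u k) x ^ 2 ≤ 0 := fun k _ => by
    by_cases hk : E ≤ l k
    · rw [hx1 k hk]
      simp
    · exact mul_nonpos_of_nonpos_of_nonneg (by linarith [not_le.1 hk]) (sq_nonneg _)
  have p3 : ∑ k, (l k - E) * inner ℝ (u k) x ^ 2 = 0 :=
    le_antisymm (Finset.sum_nonpos p1) (s1 ▸ p2)
  have p4 := (Finset.sum_eq_zero_iff_of_nonpos p1).1 p3
  have p5 : ∀ k, inner ℝ (u k) x = 0 := fun k => by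
    by_cases hk : E ≤ l k
    · exact hx1 k hk
    · have := p4 k (Finset.mem_univ k)
      rcases mul_eq_zero.1 this with h0 | h0
      · exact absurd (by linarith) hk
      · exact pow_eq_zero_iff two_ne_zero |>.1 h0
  have hx0 : x = 0 := by
    rw [← u.sum_repr' x]
    simp [p5]
  refine hd0 (funext fun k => ?_)
  rw [← hxd k, hx0, inner_zero_right]
  rfl

open Classical in
theorem card_mul_eq_sum_indicator (l : ι → ℝ) (f : ℝ → ℝ) (E : ℝ) :
    ((Finset.univ.filter fun k => E ≤ l k).card : ℝ) * f E
      = ∑ k, (Set.Iic (l k)).indicator f E := by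
  simp only [Set.indicator_apply, Set.mem_Iic]
  rw [← Finset.sum_filter, Finset.sum_const, nsmul_eq_mul]

open Classical in
theorem integrableOn_card_mul (l : ι → ℝ) (p : Polynomial ℝ) (M : ℝ) :
    IntegrableOn (fun E => ((Finset.univ.filter fun k => E ≤ l k).card : ℝ) * p.eval E)
      (Set.Ioc (-M) M) := by
  rw [funext fun E => card_mul_eq_sum_indicator l (fun E => p.eval E) E]
  exact integrable_finsetSum _ fun k _ =>
    (p.continuous.integrableOn_Ioc).indicator measurableSet_Iic

-- Layer-cake formula: each eigenvalue contributes the integral of the derivative up to it, and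
-- these add up to the counting function.
open Classical in
theorem sum_eval_eq_integral {M : ℝ} (Φ : Polynomial ℝ) {l : ι → ℝ} (hl : ∀ k, |l k| ≤ M) :
    ∑ k, (Φ.eval (l k) - Φ.eval (-M)) = ∫ E in Set.Ioc (-M) M,
      ((Finset.univ.filter fun k => E ≤ l k).card : ℝ) * (Polynomial.derivative Φ).eval E := by
  have h1 : ∀ k, Φ.eval (l k) - Φ.eval (-M) = ∫ E in Set.Ioc (-M) M,
      (Set.Iic (l k)).indicator (fun E => (Polynomial.derivative Φ).eval E) E := fun k => by
    obtain ⟨h, h'⟩ := abs_le.1 (hl k)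
    rw [setIntegral_indicator measurableSet_Iic, Set.Ioc_inter_Iic, min_eq_right h',
      ← intervalIntegral.integral_of_le h]
    exact (intervalIntegral.integral_eq_sub_of_hasDerivAt (fun x _ => Φ.hasDerivAt x)
      ((Polynomial.continuous _).intervalIntegrable _ _)).symm
  rw [Finset.sum_congr rfl fun k _ => h1 k, ← integral_finsetSum]
  · refine integral_congr_ae (Filter.Eventually.of_forall fun E => ?_)
    exact (card_mul_eq_sum_indicator l (fun E => (Polynomial.derivative Φ).eval E) E).symm
  · intro k _
    exact ((Polynomial.continuous _).integrableOn_Ioc).indicator measurableSet_Iic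

/-- The difference of the counting functions is at most two and is integrated against a nonnegative
derivative. -/
theorem sum_eval_sub_le {S S' : V →L[ℝ] V} (u : OrthonormalBasis ι ℝ V)
    (u' : OrthonormalBasis κ ℝ V) {l : ι → ℝ} {l' : κ → ℝ} (hS : ∀ k, S (u k) = l k • u k)
    (hS' : ∀ k, S' (u' k) = l' k • u' k) (e₁ e₂ : V)
    (h : ∀ x, inner ℝ e₁ x = 0 → inner ℝ e₂ x = 0 → inner ℝ x (S x) = inner ℝ x (S' x))
    {M : ℝ} (hM : 0 ≤ M) (hl : ∀ k, |l k| ≤ M) (hl' : ∀ k, |l' k| ≤ M) (Φ : Polynomial ℝ)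
    (hΦ : ∀ x ∈ Set.Icc (-M) M, 0 ≤ (Polynomial.derivative Φ).eval x) :
    ∑ k, Φ.eval (l' k) - ∑ k, Φ.eval (l k)
      ≤ 2 * ∫ x in (-M)..M, (Polynomial.derivative Φ).eval x := by
  classical
  have hcard : Fintype.card ι = Fintype.card κ := by
    rw [← Module.finrank_eq_card_basis u.toBasis, ← Module.finrank_eq_card_basis u'.toBasis]
  have e : ∑ k, Φ.eval (l' k) - ∑ k, Φ.eval (l k)
      = ∑ k, (Φ.eval (l' k) - Φ.eval (-M)) - ∑ k, (Φ.eval (l k) - Φ.eval (-M)) := by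
    simp only [Finset.sum_sub_distrib, Finset.sum_const, Finset.card_univ, hcard]
    ring
  have hF : IntegrableOn (fun E => (Polynomial.derivative Φ).eval E) (Set.Ioc (-M) M) :=
    (Polynomial.continuous _).integrableOn_Ioc
  rw [e, sum_eval_eq_integral Φ hl, sum_eval_eq_integral Φ hl',
    intervalIntegral.integral_of_le (by linarith), sub_le_iff_le_add, ← integral_const_mul,
    ← integral_add (hF.const_mul 2) (integrableOn_card_mul l _ M)]
  refine setIntegral_mono_on (integrableOn_card_mul l' _ M) ((hF.const_mul 2).add (integrableOn_card_mul l _ M)) measurableSet_Ioc ?_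
  intro E hE
  rw [← add_mul]
  refine mul_le_mul_of_nonneg_right ?_ (hΦ E (Set.Ioc_subset_Icc_self hE))
  have := card_eigenvalues_le u u' hS hS' e₁ e₂ h E
  rw [add_comm]
  exact_mod_cast this

theorem exists_polynomial_derivative_eq (F : Polynomial ℝ) :
    ∃ Φ : Polynomial ℝ, Polynomial.derivative Φ = F := by
  induction F using Polynomial.induction_on' with
  | add p q hp hq =>
    obtain ⟨P, rfl⟩ := hp
    obtain ⟨Q, rfl⟩ := hq
    exact ⟨P + Q, map_add _ _ _⟩
  | monomial n c =>
    refine ⟨Polynomial.monomial (n + 1) (c / (n + 1)), ?_⟩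
    rw [Polynomial.derivative_monomial]
    have : (n : ℝ) + 1 ≠ 0 := by positivity
    simp [this]

/-- Spectral averaging for a rank-two perturbation: for some coupling `t ∈ [0, η]` the sum of `F`
over the eigenvalues of `T + t P`, weighted by the eigenvector components along `e₁` and `e₂`, is
controlled by the energy integral of `F`. -/
theorem exists_spectral_average [FiniteDimensional ℝ V] {T P : V →L[ℝ] V} (hT : (T : V →ₗ[ℝ] V).IsSymmetric)
    (e₁ e₂ : V) (hP : ∀ x, P x = inner ℝ e₁ x • e₁ + inner ℝ e₂ x • e₂) {η M : ℝ} (hη : 0 < η)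
    (hM : 0 ≤ M)
    (hb : ∀ t ∈ Set.Icc 0 η, ∀ (l : ℝ) (x : V), x ≠ 0 → (T + t • P) x = l • x → |l| ≤ M)
    {F : ℝ → ℝ} (hF : Continuous F) (hF0 : ∀ x, 0 ≤ F x) :
    ∃ t ∈ Set.Icc 0 η, ∃ (u : OrthonormalBasis (Fin (Module.finrank ℝ V)) ℝ V)
      (l : Fin (Module.finrank ℝ V) → ℝ), (∀ k, (T + t • P) (u k) = l k • u k) ∧
      (∀ k, |l k| ≤ M) ∧
      ∑ k, (inner ℝ e₁ (u k) ^ 2 + inner ℝ e₂ (u k) ^ 2) * F (l k)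
        ≤ 2 * ((∫ x in (-M)..M, F x) + 2 * M) / η := by
  have hsymm : ∀ t : ℝ, ((T + t • P : V →L[ℝ] V) : V →ₗ[ℝ] V).IsSymmetric := fun t x y => by
    have h1 : inner ℝ (T x) y = inner ℝ x (T y) := hT x y
    simp only [ContinuousLinearMap.coe_coe, add_apply, smul_apply, hP, inner_add_left,
      inner_add_right, real_inner_smul_left, real_inner_smul_right, h1]
    rw [real_inner_comm e₁ x, real_inner_comm e₂ x]
    ring
  have hbasis : ∀ t ∈ Set.Icc 0 η, ∃ (u : OrthonormalBasis (Fin (Module.finrank ℝ V)) ℝ V)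
      (l : Fin (Module.finrank ℝ V) → ℝ), (∀ k, (T + t • P) (u k) = l k • u k) ∧
      ∀ k, |l k| ≤ M := fun t ht => by
    refine ⟨(hsymm t).eigenvectorBasis rfl, (hsymm t).eigenvalues rfl, fun k => ?_, fun k => ?_⟩
    · exact (hsymm t).apply_eigenvectorBasis rfl k
    · exact hb t ht _ _ ((hsymm t).eigenvectorBasis rfl |>.orthonormal.ne_zero k)
        ((hsymm t).apply_eigenvectorBasis rfl k)
  -- A polynomial between `F` and `F + 1` on `[-M, M]` replaces `F`; the excess costs the term `2 *
  -- M` in the final bound.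
  obtain ⟨p, hp⟩ := exists_polynomial_near_of_continuousOn (-M) M (fun x => F x + 1 / 2)
    (by fun_prop) (1 / 2) (by norm_num)
  obtain ⟨Φ, rfl⟩ := exists_polynomial_derivative_eq p
  have hlow : ∀ x ∈ Set.Icc (-M) M, F x ≤ (Polynomial.derivative Φ).eval x := fun x hx => by
    have := abs_lt.1 (hp x hx)
    linarith [this.1]
  have hupp : ∀ x ∈ Set.Icc (-M) M, (Polynomial.derivative Φ).eval x ≤ F x + 1 := fun x hx => by
    have := abs_lt.1 (hp x hx)
    linarith [this.2]
  -- The mean value theorem stands in for an average over the coupling: at this `t` the weighted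
  -- eigenvalue sum equals the slope of the trace.
  obtain ⟨t, ht, hslope⟩ := exists_hasDerivAt_eq_slope
    (fun t : ℝ => traceCLM V (Polynomial.aeval (T + t • P) Φ)) _ hη
    (fun t _ => (hasDerivAt_traceCLM_aeval T P Φ t).continuousAt.continuousWithinAt)
    (fun t _ => hasDerivAt_traceCLM_aeval T P Φ t)
  have ht' : t ∈ Set.Icc 0 η := Set.Ioo_subset_Icc_self ht
  obtain ⟨u, l, hu, hl⟩ := hbasis t ht'
  obtain ⟨u0, l0, hu0, hl0⟩ := hbasis 0 (Set.left_mem_Icc.2 hη.le)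
  obtain ⟨u1, l1, hu1, hl1⟩ := hbasis η (Set.right_mem_Icc.2 hη.le)
  have htr : ∀ (S : V →L[ℝ] V) (u : OrthonormalBasis (Fin (Module.finrank ℝ V)) ℝ V)
      (l : Fin (Module.finrank ℝ V) → ℝ), (∀ k, S (u k) = l k • u k) →
      traceCLM V (Polynomial.aeval S Φ) = ∑ k, Φ.eval (l k) := fun S u l h => by
    rw [traceCLM_eq_sum u]
    refine Finset.sum_congr rfl fun k _ => ?_
    rw [aeval_apply_eigenvector (h k), inner_smul_right, real_inner_self_eq_norm_sq,
      u.orthonormal.1 k]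
    ring
  rw [htr _ u0 l0 hu0, htr _ u1 l1 hu1, traceCLM_eq_sum u] at hslope
  have hforms : ∀ x, inner ℝ e₁ x = 0 → inner ℝ e₂ x = 0 →
      inner ℝ x ((T + (0 : ℝ) • P) x) = inner ℝ x ((T + η • P) x) := fun x h1 h2 => by
    simp [hP, h1, h2]
  have hcount := sum_eval_sub_le u0 u1 hu0 hu1 e₁ e₂ hforms hM hl0 hl1 Φ
    fun x hx => (hF0 x).trans (hlow x hx)
  refine ⟨t, ht', u, l, hu, hl, ?_⟩
  calc ∑ k, (inner ℝ e₁ (u k) ^ 2 + inner ℝ e₂ (u k) ^ 2) * F (l k)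
      ≤ ∑ k, (inner ℝ e₁ (u k) ^ 2 + inner ℝ e₂ (u k) ^ 2)
          * (Polynomial.derivative Φ).eval (l k) := by
        gcongr with k _
        exact hlow _ (abs_le.1 (hl k))
    _ = (∑ k, Φ.eval (l1 k) - ∑ k, Φ.eval (l0 k)) / (η - 0) := by
        rw [← hslope]
        refine Finset.sum_congr rfl fun k _ => ?_
        rw [mul_apply_eq_comp, aeval_apply_eigenvector (hu k), map_smul,
          inner_smul_right, hP, inner_add_right, inner_smul_right, inner_smul_right,
          real_inner_comm e₁, real_inner_comm e₂]
        ring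
    _ ≤ 2 * ((∫ x in (-M)..M, F x) + 2 * M) / η := by
        rw [sub_zero]
        refine div_le_div_of_nonneg_right (hcount.trans ?_) hη.le
        gcongr
        calc ∫ x in (-M)..M, (Polynomial.derivative Φ).eval x ≤ ∫ x in (-M)..M, (F x + 1) :=
              intervalIntegral.integral_mono_on (by linarith)
                ((Polynomial.continuous _).intervalIntegrable _ _)
                ((hF.add continuous_const).intervalIntegrable _ _) hupp
          _ = _ := by
              rw [intervalIntegral.integral_add (hF.intervalIntegrable _ _)
                (continuous_const.intervalIntegrable _ _), intervalIntegral.integral_const]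
              simp only [smul_eq_mul]
              ring

end FiniteDimensional

/-! ### Localized eigenbases in finite boxes -/

/-- The Jacobi difference expression on arbitrary real sequences. -/
def jacobiExpr (a b ψ : ℤ → ℝ) (n : ℤ) : ℝ := a n * ψ (n + 1) + a (n - 1) * ψ (n - 1) + b n * ψ n

theorem eq_smul_halfLineState {α b g : ℕ → ℝ} {E : ℝ} {L : ℕ} (hα : ∀ k, α k ≠ 0)
    (hg : g (L + 1) = 0)
    (hrec : ∀ k < L, α (k + 1) * g (k + 2) + α k * g k + b (k + 1) * g (k + 1) = E * g (k + 1))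
    {k : ℕ} (hk : k ≤ L) :
    (α k * g (k + 1), g k) = g L • halfLineState α b E L (0, 1) k := by
  induction hk using Nat.decreasingInduction with
  | self => simp [halfLineState_self, hg]
  | of_succ k hk ih =>
    rw [halfLineState_of_lt α b E hk, ← transferStep_smul, ← ih, transferStep]
    ext
    · rfl
    · simp only
      rw [eq_div_iff (hα k)]
      linarith [hrec k hk]

/-- Dirichlet data at `L + 1` determine `g` up to the factor `g L`, which cancels when `g k` is
compared with the state at `0`; a single term of the weighted sum then gives the bound. -/
theorem abs_le_of_halfLine {α b g : ℕ → ℝ} {E γ : ℝ} {L : ℕ} (hα : ∀ k, α k ≠ 0)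
    (hg : g (L + 1) = 0)
    (hrec : ∀ k < L, α (k + 1) * g (k + 2) + α k * g k + b (k + 1) * g (k + 1) = E * g (k + 1))
    {k : ℕ} (hk : k ≤ L) :
    |g k| ≤ √((α 0 * g 1) ^ 2 + g 0 ^ 2) * (1 + halfLineSum γ α b L E) * Real.exp (-(γ * k)) := by
  have hS := halfLineSum_nonneg γ α b L E
  set R := √((α 0 * g 1) ^ 2 + g 0 ^ 2) with hR
  -- The site `0` is absent from the weighted sum; the summand `1` in the bound covers it.
  rcases Nat.eq_zero_or_pos k with rfl | hk0
  · have h1 : |g 0| ≤ R := Real.abs_le_sqrt (by nlinarith [sq_nonneg (α 0 * g 1)])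
    have h2 : 0 ≤ R := Real.sqrt_nonneg _
    simp only [Nat.cast_zero, mul_zero, neg_zero, Real.exp_zero, mul_one]
    nlinarith
  set v := halfLineState α b E L (0, 1) with hv
  have h0 := eq_smul_halfLineState hα hg hrec (Nat.zero_le L)
  have h1 := eq_smul_halfLineState hα hg hrec hk
  rw [← hv] at h0 h1
  have e1 : α 0 * g 1 = g L * (v 0).1 := congrArg Prod.fst h0
  have e2 : g 0 = g L * (v 0).2 := congrArg Prod.snd h0
  have e3 : g k = g L * (v k).2 := congrArg Prod.snd h1
  have hD : 0 < √((v 0).1 ^ 2 + (v 0).2 ^ 2) := Real.sqrt_pos.2 (sq_add_sq_pos_of_ne_zero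
    (halfLineState_ne_zero hα b E L (v := (0, 1)) (by simp) 0))
  have hRD : R = |g L| * √((v 0).1 ^ 2 + (v 0).2 ^ 2) := by
    rw [hR, e1, e2, mul_pow, mul_pow, ← mul_add, Real.sqrt_mul (sq_nonneg _), Real.sqrt_sq_eq_abs]
  have h2 : Real.exp (γ * k) * |(v k).2| ≤ halfLineSum γ α b L E
      * √((v 0).1 ^ 2 + (v 0).2 ^ 2) := by
    unfold halfLineSum
    rw [← hv, div_mul_cancel₀ _ hD.ne']
    exact Finset.single_le_sum (f := fun m : ℕ => Real.exp (γ * m) * |(v m).2|)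
      (fun m _ => by positivity) (Finset.mem_Icc.2 ⟨hk0, hk⟩)
  rw [Real.exp_neg, ← div_eq_mul_inv, le_div_iff₀ (Real.exp_pos _), e3, abs_mul, hRD]
  calc |g L| * |(v k).2| * Real.exp (γ * k) = |g L| * (Real.exp (γ * k) * |(v k).2|) := by ring
    _ ≤ |g L| * (halfLineSum γ α b L E * √((v 0).1 ^ 2 + (v 0).2 ^ 2)) := by gcongr
    _ ≤ |g L| * ((1 + halfLineSum γ α b L E) * √((v 0).1 ^ 2 + (v 0).2 ^ 2)) := by
        gcongr
        linarith
    _ = _ := by ring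

section Box

variable (s : Finset ℤ)

/-- Extension by zero of a function on a finite set of sites. -/
noncomputable def zeroExtend (x : EuclideanSpace ℝ s) (n : ℤ) : ℝ :=
  if h : n ∈ s then x ⟨n, h⟩ else 0

theorem zeroExtend_coe (x : EuclideanSpace ℝ s) (n : s) : zeroExtend s x n = x n := by
  simp [zeroExtend]

theorem zeroExtend_of_notMem (x : EuclideanSpace ℝ s) {n : ℤ} (h : n ∉ s) :
    zeroExtend s x n = 0 := by
  simp [zeroExtend, h]

theorem inner_eq_sum_zeroExtend (x y : EuclideanSpace ℝ s) :
    inner ℝ x y = ∑ n ∈ s, zeroExtend s x n * zeroExtend s y n := by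
  rw [← Finset.sum_coe_sort, PiLp.inner_apply]
  refine Finset.sum_congr rfl fun n _ => ?_
  rw [zeroExtend_coe, zeroExtend_coe]
  simp [mul_comm]

/-- The compression of the Jacobi expression to a finite set of sites. -/
noncomputable def boxJacobi (a b : ℤ → ℝ) : EuclideanSpace ℝ s →L[ℝ] EuclideanSpace ℝ s :=
  LinearMap.toContinuousLinearMap
    { toFun := fun x => WithLp.toLp 2 fun n => jacobiExpr a b (zeroExtend s x) n
      map_add' := fun x y => by
        ext n
        simp only [jacobiExpr, zeroExtend, PiLp.add_apply]
        split_ifs <;> ring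
      map_smul' := fun c x => by
        ext n
        simp only [jacobiExpr, zeroExtend, PiLp.smul_apply, smul_eq_mul, RingHom.id_apply]
        split_ifs <;> ring }

theorem boxJacobi_apply (a b : ℤ → ℝ) (x : EuclideanSpace ℝ s) (n : s) :
    boxJacobi s a b x n = jacobiExpr a b (zeroExtend s x) n := rfl

theorem isSymmetric_boxJacobi (a b : ℤ → ℝ) :
    (boxJacobi s a b : EuclideanSpace ℝ s →ₗ[ℝ] EuclideanSpace ℝ s).IsSymmetric := by
  have key : ∀ x y : EuclideanSpace ℝ s, inner ℝ (boxJacobi s a b x) y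
      = ∑' n : ℤ, (a n * zeroExtend s x (n + 1) * zeroExtend s y n
        + a n * zeroExtend s x n * zeroExtend s y (n + 1)
        + b n * zeroExtend s x n * zeroExtend s y n) := by
    intro x y
    set X := zeroExtend s x
    set Y := zeroExtend s y
    have hY : ∀ n, n ∉ s → Y n = 0 := fun n hn => zeroExtend_of_notMem s y hn
    have hf : ∀ (f : ℤ → ℝ), Summable fun n => f n * Y n := fun f =>
      summable_of_ne_finset_zero (s := s) fun n hn => by rw [hY n hn, mul_zero]
    have h2 : ∑' n, a (n - 1) * X (n - 1) * Y n = ∑' n, a n * X n * Y (n + 1) := by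
      rw [← (Equiv.addRight (1 : ℤ)).tsum_eq (fun n => a (n - 1) * X (n - 1) * Y n)]
      simp
    have hs2 : Summable fun n => a n * X n * Y (n + 1) := by
      have := (Equiv.addRight (1 : ℤ)).summable_iff.2 (hf fun n => a (n - 1) * X (n - 1))
      simpa [Function.comp_def] using this
    rw [inner_eq_sum_zeroExtend, Finset.sum_congr rfl (g := fun n =>
      (a n * X (n + 1) + a (n - 1) * X (n - 1) + b n * X n) * Y n)]
    · rw [← tsum_eq_sum (L := .unconditional ℤ)
        (f := fun n => (a n * X (n + 1) + a (n - 1) * X (n - 1) + b n * X n) * Y n)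
        fun n hn => by rw [hY n hn, mul_zero]]
      simp only [add_mul]
      rw [((hf _).add (hf _)).tsum_add (hf _), (hf _).tsum_add (hf _), h2,
        ((hf _).add hs2).tsum_add (hf _), (hf _).tsum_add hs2]
    · intro n hn
      rw [show zeroExtend s (boxJacobi s a b x) n = jacobiExpr a b X n from
        (zeroExtend_coe s _ ⟨n, hn⟩).trans (boxJacobi_apply s a b x ⟨n, hn⟩)]
      rfl
  intro x y
  change inner ℝ (boxJacobi s a b x) y = inner ℝ x (boxJacobi s a b y)
  rw [real_inner_comm (boxJacobi s a b y) x, key, key]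
  refine tsum_congr fun n => by ring

-- The eigenvalue equation is read at a site where the eigenvector is largest in modulus.
variable {s} in
theorem abs_eigenvalue_le_of_box {a b : ℤ → ℝ} {A B : ℝ} (ha : ∀ n, |a n| ≤ A)
    (hb : ∀ n, |b n| ≤ B) {x : EuclideanSpace ℝ s} (hx : x ≠ 0) {l : ℝ}
    (h : ∀ n ∈ s, jacobiExpr a b (zeroExtend s x) n = l * zeroExtend s x n) :
    |l| ≤ 2 * A + B := by
  obtain ⟨m, hm⟩ : ∃ m, x m ≠ 0 := by
    by_contra! hc
    exact hx (PiLp.ext hc)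
  obtain ⟨n, hn, hmax⟩ := s.exists_max_image (fun n => |zeroExtend s x n|) ⟨m, m.2⟩
  set X := zeroExtend s x with hX
  have hpos : 0 < |X n| := lt_of_lt_of_le (abs_pos.2 (by rwa [hX, zeroExtend_coe])) (hmax m m.2)
  have hle : ∀ k, |X k| ≤ |X n| := fun k => by
    by_cases hk : k ∈ s
    · exact hmax k hk
    · rw [hX, zeroExtend_of_notMem s x hk, abs_zero]
      exact abs_nonneg _
  refine le_of_mul_le_mul_right ?_ hpos
  rw [← abs_mul, ← h n hn, jacobiExpr]
  refine (abs_add_three _ _ _).trans ?_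
  rw [abs_mul, abs_mul, abs_mul]
  have h1 := mul_le_mul (ha n) (hle (n + 1)) (abs_nonneg _) ((abs_nonneg _).trans (ha n))
  have h2 := mul_le_mul (ha (n - 1)) (hle (n - 1)) (abs_nonneg _) ((abs_nonneg _).trans (ha n))
  have h3 := mul_le_mul_of_nonneg_right (hb n) (abs_nonneg (X n))
  linarith

end Box

theorem exp_decay_of_box {a b : ℤ → ℝ} {A D M γ E : ℝ} (hγ : 0 < γ) (ha0 : ∀ n, 0 < a n)
    (haA : ∀ n, a n ≤ A) (hb : ∀ n, |b n| ≤ D) (hE : |E| ≤ M) {L : ℕ} {ψ : ℤ → ℝ}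
    (hout : ∀ n ∉ Finset.Icc (-(L : ℤ)) (L + 1), ψ n = 0)
    (hψ : ∀ n ∈ Finset.Icc (-(L : ℤ)) (L + 1), jacobiExpr a b ψ n = E * ψ n) (n : ℤ) :
    |ψ n| ≤ (M + D + A + 1) * Real.exp γ * √(ψ 0 ^ 2 + ψ 1 ^ 2)
      * (1 + (halfLineSum γ (fun k => a (1 + k)) (fun k => b (1 + k)) L E
        + halfLineSum γ (fun k => a (-k - 1)) (fun k => b (-k)) L E))
      * Real.exp (-γ * |(n : ℝ)|) := by
  set θ := √(ψ 0 ^ 2 + ψ 1 ^ 2) with hθ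
  have hθ0 : 0 ≤ θ := Real.sqrt_nonneg _
  set FR := halfLineSum γ (fun k : ℕ => a (1 + k)) (fun k => b (1 + k)) L E with hFR
  set FL := halfLineSum γ (fun k : ℕ => a (-k - 1)) (fun k => b (-k)) L E with hFL
  have hFR0 : 0 ≤ FR := halfLineSum_nonneg _ _ _ _ _
  have hFL0 : 0 ≤ FL := halfLineSum_nonneg _ _ _ _ _
  have hA0 : 0 ≤ A := (ha0 0).le.trans (haA 0)
  have hM0 : 0 ≤ M := (abs_nonneg _).trans hE
  have hD0 : 0 ≤ D := (abs_nonneg _).trans (hb 0)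
  have hC0 : 0 ≤ M + D + A + 1 := by positivity
  have i0 : |ψ 0| ≤ θ := Real.abs_le_sqrt (by nlinarith [sq_nonneg (ψ 1)])
  have i1 : |ψ 1| ≤ θ := Real.abs_le_sqrt (by nlinarith [sq_nonneg (ψ 0)])
  have hexp1 : 1 ≤ Real.exp γ := Real.one_le_exp hγ.le
  -- The eigenvalue equation at the inner end of each half line expresses its initial state through
  -- `ψ 0` and `ψ 1` alone: `a 1 * ψ 2 = (E - b 1) * ψ 1 - a 0 * ψ 0` on the right, and
  -- symmetrically on the left.
  have hbd : ∀ (β x y : ℝ), |β| ≤ D → |x| ≤ θ → |y| ≤ θ →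
      √(((E - β) * x - a 0 * y) ^ 2 + x ^ 2) ≤ (M + D + A + 1) * θ := by
    intro β x y hβ hx hy
    have h1 : |(E - β) * x - a 0 * y| ≤ (M + D + A) * θ := by
      calc |(E - β) * x - a 0 * y| ≤ |(E - β) * x| + |a 0 * y| := abs_sub _ _
        _ = |E - β| * |x| + a 0 * |y| := by rw [abs_mul, abs_mul, abs_of_pos (ha0 0)]
        _ ≤ (M + D) * θ + A * θ := by
          gcongr
          · exact (abs_sub _ _).trans (add_le_add hE hβ)
          · exact haA 0
        _ = _ := by ring
    refine Real.sqrt_le_iff.2 ⟨by positivity, ?_⟩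
    have h2 := sq_le_sq' (neg_le_of_abs_le h1) (le_of_abs_le h1)
    have h3 := sq_le_sq' (neg_le_of_abs_le hx) (le_of_abs_le hx)
    have h4 : 0 ≤ (M + D + A) * θ * θ := by positivity
    nlinarith
  by_cases hn : n ∈ Finset.Icc (-(L : ℤ)) (L + 1)
  swap
  · rw [hout n hn, abs_zero]
    positivity
  rw [Finset.mem_Icc] at hn
  rcases lt_or_ge 0 n with hpos | hneg
  · obtain ⟨k, rfl⟩ : ∃ k : ℕ, n = 1 + k := ⟨(n - 1).toNat, by omega⟩
    have h := abs_le_of_halfLine (α := fun k : ℕ => a (1 + k)) (b := fun k : ℕ => b (1 + k))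
      (g := fun k : ℕ => ψ (1 + k)) (E := E) (γ := γ) (L := L) (fun k => (ha0 _).ne')
      (hout _ (by simp)) (fun k hk => by
        have := hψ (1 + (k + 1 : ℕ)) (by simp; omega)
        simp only [jacobiExpr] at this
        push_cast at this ⊢
        rw [← this]
        ring_nf) (k := k) (by omega)
    have e1 : (fun k : ℕ => a (1 + k)) 0 * (fun k : ℕ => ψ (1 + k)) 1
        = (E - b 1) * ψ 1 - a 0 * ψ 0 := by
      have := hψ 1 (by simp)
      simp only [jacobiExpr] at this
      norm_num at this ⊢
      linarith
    rw [e1] at h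
    simp only [Nat.cast_zero, add_zero] at h
    rw [← hFR] at h
    refine h.trans ?_
    -- The right half line starts at the site `1`; the factor `Real.exp γ` in the constant
    -- compensates for this shift.
    have e2 : Real.exp (-γ * |((1 + k : ℤ) : ℝ)|) = Real.exp (-γ) * Real.exp (-(γ * k)) := by
      rw [← Real.exp_add]
      push_cast
      rw [abs_of_nonneg (by positivity)]
      ring_nf
    rw [e2]
    calc √(((E - b 1) * ψ 1 - a 0 * ψ 0) ^ 2 + ψ 1 ^ 2) * (1 + FR) * Real.exp (-(γ * k))
        ≤ ((M + D + A + 1) * θ) * (1 + (FR + FL)) * Real.exp (-(γ * k)) := by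
          gcongr
          · exact hbd _ _ _ (hb 1) i1 i0
          · linarith
      _ = (M + D + A + 1) * (Real.exp γ * Real.exp (-γ)) * θ * (1 + (FR + FL))
          * Real.exp (-(γ * k)) := by
          rw [← Real.exp_add, add_neg_cancel, Real.exp_zero]
          ring
      _ = _ := by ring
  · obtain ⟨k, rfl⟩ : ∃ k : ℕ, n = -k := ⟨(-n).toNat, by omega⟩
    have h := abs_le_of_halfLine (α := fun k : ℕ => a (-k - 1)) (b := fun k : ℕ => b (-k))
      (g := fun k : ℕ => ψ (-k)) (E := E) (γ := γ) (L := L) (fun k => (ha0 _).ne')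
      (hout _ (by simp)) (fun k hk => by
        have := hψ (-(k + 1 : ℕ)) (by simp; omega)
        simp only [jacobiExpr] at this
        push_cast at this ⊢
        rw [← this]
        ring_nf) (k := k) (by omega)
    have e1 : (fun k : ℕ => a (-k - 1)) 0 * (fun k : ℕ => ψ (-k)) 1
        = (E - b 0) * ψ 0 - a 0 * ψ 1 := by
      have := hψ 0 (by simp; omega)
      simp only [jacobiExpr] at this
      norm_num at this ⊢
      linarith
    rw [e1] at h
    simp only [Nat.cast_zero, neg_zero] at h
    rw [← hFL] at h
    refine h.trans ?_
    have e2 : Real.exp (-γ * |((-k : ℤ) : ℝ)|) = Real.exp (-(γ * k)) := by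
      push_cast
      rw [abs_neg, abs_of_nonneg (by positivity)]
      ring_nf
    rw [e2]
    calc √(((E - b 0) * ψ 0 - a 0 * ψ 1) ^ 2 + ψ 0 ^ 2) * (1 + FL) * Real.exp (-(γ * k))
        ≤ ((M + D + A + 1) * θ) * (1 + (FR + FL)) * Real.exp (-(γ * k)) := by
          gcongr
          · exact hbd _ _ _ (hb 0) i0 i1
          · linarith
      _ = (M + D + A + 1) * 1 * θ * (1 + (FR + FL)) * Real.exp (-(γ * k)) := by ring
      _ ≤ _ := by gcongr

/-- Uniform localization in boxes: for every box `[-L, L + 1]` a perturbation of the potential by at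
most `2η` can be chosen so that the box operator has an orthonormal eigenbasis which is
exponentially localized, with constants independent of `L`. -/
theorem exists_localized_box {a b : ℤ → ℝ} {A B : ℝ} (ha0 : ∀ n, 0 < a n) (haA : ∀ n, a n ≤ A)
    (hb : ∀ n, |b n| ≤ B) {η : ℝ} (hη : 0 < η) :
    ∃ C γ M : ℝ, 0 < C ∧ 0 < γ ∧ ∀ L : ℕ, ∃ (b' : ℤ → ℝ) (N : ℕ) (l : Fin N → ℝ)
      (ψ : Fin N → ℤ → ℝ) (F : Fin N → ℝ),
      (∀ n, b n ≤ b' n ∧ b' n ≤ b n + 2 * η) ∧ (∀ k, |l k| ≤ M) ∧ (∀ k, 0 ≤ F k) ∧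
      (∀ k, ∀ n ∈ Finset.Icc (-(L : ℤ)) (L + 1), jacobiExpr a b' (ψ k) n = l k * ψ k n) ∧
      (∀ k, ∀ n ∉ Finset.Icc (-(L : ℤ)) (L + 1), ψ k n = 0) ∧
      (∀ k n, |ψ k n| ≤ C * √(ψ k 0 ^ 2 + ψ k 1 ^ 2) * (1 + F k) * Real.exp (-γ * |(n : ℝ)|)) ∧
      ∑ k, (ψ k 0 ^ 2 + ψ k 1 ^ 2) * F k ≤ C ∧
      ∀ w : ℤ → ℝ, (∀ n ∈ Finset.Icc (-(L : ℤ)) (L + 1),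
          w n = ∑ k, ψ k n * ∑ m ∈ Finset.Icc (-(L : ℤ)) (L + 1), ψ k m * w m) ∧
        ∑ k, (∑ m ∈ Finset.Icc (-(L : ℤ)) (L + 1), ψ k m * w m) ^ 2
          = ∑ m ∈ Finset.Icc (-(L : ℤ)) (L + 1), w m ^ 2 := by
  have hA : 0 < A := (ha0 0).trans_le (haA 0)
  have hB : 0 ≤ B := (abs_nonneg _).trans (hb 0)
  set D := B + 2 * η with hD
  set M := 2 * A + D with hM
  have hM0 : 0 ≤ M := by positivity
  obtain ⟨C₀, γ, hγ, hhalf⟩ := exists_halfLineSum_integral_le hη A hM0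
  set C₁ := max ((M + D + A + 1) * Real.exp γ) (2 * (2 * C₀ + 2 * M) / η) with hC₁
  have hC₁pos : 0 < (M + D + A + 1) * Real.exp γ := by positivity
  refine ⟨C₁, γ, M, lt_max_of_lt_left hC₁pos, hγ, fun L => ?_⟩
  obtain ⟨bR, hbR, hR⟩ := hhalf (fun k => a (1 + k)) (fun k => b (1 + k)) L
    fun k => ⟨ha0 _, haA _⟩
  obtain ⟨bL, hbL, hL⟩ := hhalf (fun k => a (-k - 1)) (fun k => b (-k)) L
    fun k => ⟨ha0 _, haA _⟩
  set s := Finset.Icc (-(L : ℤ)) (L + 1) with hs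
  have h0s : (0 : ℤ) ∈ s := by simp [hs]; omega
  have h1s : (1 : ℤ) ∈ s := by simp [hs]
  -- The half-line sums see only the sites `1 + k` and `-k` with `k ≥ 1`. Putting the coupling on
  -- `0` and `1` therefore leaves them unchanged, and they can serve as the `t`-independent function
  -- `F` in the spectral average.
  let β : ℝ → ℤ → ℝ := fun t n =>
    if 1 < n then bR (n - 1).toNat else if n < 0 then bL (-n).toNat else b n + t
  have hβ : ∀ t ∈ Set.Icc 0 η, ∀ n, b n ≤ β t n ∧ β t n ≤ b n + 2 * η := by
    intro t ht n
    simp only [β]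
    split_ifs with h1 h2
    · have := hbR (n - 1).toNat
      have e : (1 + ((n - 1).toNat : ℤ)) = n := by omega
      rwa [e] at this
    · have := hbL (-n).toNat
      have e : (-((-n).toNat : ℤ)) = n := by omega
      rwa [e] at this
    · constructor <;> linarith [ht.1, ht.2]
  have hβD : ∀ t ∈ Set.Icc 0 η, ∀ n, |β t n| ≤ D := fun t ht n => by
    obtain ⟨h1, h2⟩ := hβ t ht n
    obtain ⟨h3, h4⟩ := abs_le.1 (hb n)
    rw [abs_le]
    constructor <;> linarith
  set e₁ : EuclideanSpace ℝ s := EuclideanSpace.single ⟨0, h0s⟩ 1 with he₁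
  set e₂ : EuclideanSpace ℝ s := EuclideanSpace.single ⟨1, h1s⟩ 1 with he₂
  have hi₁ : ∀ x, inner ℝ e₁ x = zeroExtend s x 0 := fun x => by
    rw [he₁, EuclideanSpace.inner_single_left]
    simp [zeroExtend, h0s]
  have hi₂ : ∀ x, inner ℝ e₂ x = zeroExtend s x 1 := fun x => by
    rw [he₂, EuclideanSpace.inner_single_left]
    simp [zeroExtend, h1s]
  set P : EuclideanSpace ℝ s →L[ℝ] EuclideanSpace ℝ s :=
    (innerSL ℝ e₁).smulRight e₁ + (innerSL ℝ e₂).smulRight e₂ with hP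
  have hPx : ∀ x, P x = inner ℝ e₁ x • e₁ + inner ℝ e₂ x • e₂ := fun x => rfl
  have hT : ∀ (t : ℝ) (x : EuclideanSpace ℝ s),
      (boxJacobi s a (β 0) + t • P) x = boxJacobi s a (β t) x := by
    intro t x
    ext n
    obtain ⟨n, hn⟩ := n
    have c₁ : e₁ ⟨n, hn⟩ = if n = 0 then 1 else 0 := by simp [he₁, PiLp.single_apply]
    have c₂ : e₂ ⟨n, hn⟩ = if n = 1 then 1 else 0 := by simp [he₂, PiLp.single_apply]
    simp only [add_apply, smul_apply, PiLp.add_apply, PiLp.smul_apply, hPx, hi₁, hi₂, smul_eq_mul,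
      boxJacobi_apply, jacobiExpr, c₁, c₂, β]
    rcases eq_or_ne n 0 with rfl | h0
    · norm_num
      ring
    rcases eq_or_ne n 1 with rfl | h1
    · norm_num
      ring
    · rw [if_neg h0, if_neg h1]
      split_ifs
      · ring
      · ring
      · omega
  have heig : ∀ (t l : ℝ) (x : EuclideanSpace ℝ s), (boxJacobi s a (β 0) + t • P) x = l • x →
      ∀ n ∈ s, jacobiExpr a (β t) (zeroExtend s x) n = l * zeroExtend s x n := by
    intro t l x h n hn
    rw [hT] at h
    have h2 := congrArg (fun y : EuclideanSpace ℝ s => y ⟨n, hn⟩) h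
    simp only [boxJacobi_apply, PiLp.smul_apply, smul_eq_mul] at h2
    rw [h2, ← zeroExtend_coe]
  have hcR := continuous_halfLineSum γ (α := fun k : ℕ => a (1 + k)) (fun k => (ha0 _).ne') bR L
  have hcL := continuous_halfLineSum γ (α := fun k : ℕ => a (-k - 1)) (fun k => (ha0 _).ne') bL L
  obtain ⟨t, ht, u, l, hul, hlM, hsum⟩ := exists_spectral_average (isSymmetric_boxJacobi s a (β 0))
    e₁ e₂ hPx hη hM0 (fun t ht l x hx h => abs_eigenvalue_le_of_box
      (fun n => by rw [abs_of_pos (ha0 n)]; exact haA n) (hβD t ht) hx (heig t l x h))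
    (hcR.fun_add hcL) (fun x => add_nonneg (halfLineSum_nonneg _ _ _ _ _) (halfLineSum_nonneg _ _ _ _ _))
  refine ⟨β t, _, l, fun k => zeroExtend s (u k), fun k => _, hβ t ht, hlM,
    fun k => add_nonneg (halfLineSum_nonneg γ (fun k : ℕ => a (1 + k)) bR L (l k))
      (halfLineSum_nonneg γ (fun k : ℕ => a (-k - 1)) bL L (l k)),
    fun k => heig t (l k) (u k) (hul k), fun k n hn => zeroExtend_of_notMem s _ hn, ?_, ?_, ?_⟩
  · intro k n
    have h := exp_decay_of_box (A := A) (D := D) hγ ha0 haA (hβD t ht) (hlM k)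
      (fun n hn => zeroExtend_of_notMem s (u k) hn) (heig t (l k) (u k) (hul k)) n
    have eR : ∀ k : ℕ, 1 ≤ k → k ≤ L → β t (1 + k) = bR k := fun k h1 _ => by
      simp only [β]
      rw [if_pos (by omega)]
      congr 1
      omega
    have eL : ∀ k : ℕ, 1 ≤ k → k ≤ L → β t (-k) = bL k := fun k h1 _ => by
      simp only [β]
      rw [if_neg (by omega), if_pos (by omega)]
      congr 1
      omega
    rw [halfLineSum_congr γ (b := fun k : ℕ => β t (1 + k)) eR,
      halfLineSum_congr γ (b := fun k : ℕ => β t (-k)) eL] at h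
    refine h.trans ?_
    have := halfLineSum_nonneg γ (fun k : ℕ => a (1 + k)) bR L (l k)
    have := halfLineSum_nonneg γ (fun k : ℕ => a (-k - 1)) bL L (l k)
    gcongr
    exact le_max_left _ _
  · simp only [hi₁, hi₂] at hsum
    refine hsum.trans (le_trans ?_ (le_max_right _ _))
    rw [intervalIntegral.integral_add (hcR.intervalIntegrable _ _) (hcL.intervalIntegrable _ _)]
    gcongr
    linarith
  · intro w
    set W : EuclideanSpace ℝ s := WithLp.toLp 2 fun n => w n with hW
    have hWn : ∀ n ∈ s, zeroExtend s W n = w n := fun n hn => by simp [zeroExtend, hn, hW]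
    have hc : ∀ k, ∑ m ∈ s, zeroExtend s (u k) m * w m = inner ℝ (u k) W := fun k => by
      rw [inner_eq_sum_zeroExtend]
      exact Finset.sum_congr rfl fun m hm => by rw [hWn m hm]
    simp only [hc]
    constructor
    · intro n hn
      have h1 := congrArg (fun y : EuclideanSpace ℝ s => y ⟨n, hn⟩) (u.sum_repr' W)
      simp only [WithLp.ofLp_sum, WithLp.ofLp_smul, Finset.sum_apply, Pi.smul_apply,
        smul_eq_mul] at h1
      rw [← hWn n hn, zeroExtend_coe s W ⟨n, hn⟩, ← h1]
      exact Finset.sum_congr rfl fun k _ => by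
        rw [show zeroExtend s (u k) n = u k ⟨n, hn⟩ from zeroExtend_coe s _ ⟨n, hn⟩, mul_comm]
    · have h1 := u.sum_sq_norm_inner_right W
      rw [← real_inner_self_eq_norm_sq, inner_eq_sum_zeroExtend] at h1
      simp only [Real.norm_eq_abs, sq_abs] at h1
      rw [h1]
      exact Finset.sum_congr rfl fun m hm => by rw [hWn m hm, sq]

/-! ### Passage to infinite volume -/

/-- Put `W = ∑ x k * c k`. Indices with `F k > K` carry little of `∑ θ k ^ 2`, so by Cauchy–Schwarz
they contribute at most `|W| / 2`. If all the others had `|c k| ≤ |W| / 8 * θ k`, they would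
contribute at most `|W| / 4`, which is too little in total. -/
theorem exists_large_coefficient {N : ℕ} {x c θ F : Fin N → ℝ} {C S K : ℝ} (hK : 0 < K)
    (hx : ∀ k, |x k| ≤ θ k) (hθ : ∑ k, θ k ^ 2 ≤ 2) (hF : ∀ k, 0 ≤ F k)
    (hθF : ∑ k, θ k ^ 2 * F k ≤ C) (hc : ∑ k, c k ^ 2 ≤ S)
    (hW : 4 * (C * S) < K * (∑ k, x k * c k) ^ 2) :
    ∃ k, F k ≤ K ∧ |∑ k, x k * c k| / 8 * θ k < |c k| := by
  by_contra! hcon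
  set W := ∑ k, x k * c k with hWdef
  have hθ0 : ∀ k, 0 ≤ θ k := fun k => (abs_nonneg _).trans (hx k)
  have hC0 : 0 ≤ C := le_trans (Finset.sum_nonneg fun k _ => mul_nonneg (sq_nonneg _) (hF k)) hθF
  have hS0 : 0 ≤ S := le_trans (Finset.sum_nonneg fun k _ => sq_nonneg _) hc
  set good := Finset.univ.filter fun k => F k ≤ K with hgood
  set bad := Finset.univ.filter fun k => ¬ F k ≤ K with hbad
  have hsplit : W = ∑ k ∈ good, x k * c k + ∑ k ∈ bad, x k * c k :=
    (Finset.sum_filter_add_sum_filter_not _ _ _).symm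
  have h1 : |∑ k ∈ good, x k * c k| ≤ |W| / 4 := by
    calc |∑ k ∈ good, x k * c k| ≤ ∑ k ∈ good, |x k * c k| := Finset.abs_sum_le_sum_abs _ _
      _ ≤ ∑ k ∈ good, |W| / 8 * θ k ^ 2 := by
        refine Finset.sum_le_sum fun k hk => ?_
        have hk' := hcon k (Finset.mem_filter.1 hk).2
        rw [abs_mul]
        calc |x k| * |c k| ≤ θ k * (|W| / 8 * θ k) :=
              mul_le_mul (hx k) hk' (abs_nonneg _) (hθ0 k)
          _ = _ := by ring
      _ ≤ ∑ k, |W| / 8 * θ k ^ 2 :=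
        Finset.sum_le_sum_of_subset_of_nonneg (Finset.filter_subset _ _) fun k _ _ => by positivity
      _ ≤ |W| / 8 * 2 := by
        rw [← Finset.mul_sum]
        gcongr
      _ = _ := by ring
  have h2 : K * (∑ k ∈ bad, x k * c k) ^ 2 ≤ C * S := by
    have hcs := Finset.sum_mul_sq_le_sq_mul_sq bad x c
    have hb1 : K * ∑ k ∈ bad, x k ^ 2 ≤ C := by
      rw [Finset.mul_sum]
      calc ∑ k ∈ bad, K * x k ^ 2 ≤ ∑ k ∈ bad, θ k ^ 2 * F k := by
            refine Finset.sum_le_sum fun k hk => ?_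
            have hk' := not_le.1 (Finset.mem_filter.1 hk).2
            have h3 : x k ^ 2 ≤ θ k ^ 2 := by
              rw [← sq_abs]
              exact pow_le_pow_left₀ (abs_nonneg _) (hx k) 2
            nlinarith [sq_nonneg (x k)]
        _ ≤ ∑ k, θ k ^ 2 * F k := Finset.sum_le_sum_of_subset_of_nonneg (Finset.filter_subset _ _)
            fun k _ _ => mul_nonneg (sq_nonneg _) (hF k)
        _ ≤ C := hθF
    have hb2 : ∑ k ∈ bad, c k ^ 2 ≤ S :=
      (Finset.sum_le_sum_of_subset_of_nonneg (Finset.filter_subset _ _)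
        fun k _ _ => sq_nonneg _).trans hc
    calc K * (∑ k ∈ bad, x k * c k) ^ 2
        ≤ K * ((∑ k ∈ bad, x k ^ 2) * ∑ k ∈ bad, c k ^ 2) := by gcongr
      _ = (K * ∑ k ∈ bad, x k ^ 2) * ∑ k ∈ bad, c k ^ 2 := by ring
      _ ≤ C * S := mul_le_mul hb1 hb2 (Finset.sum_nonneg fun k _ => sq_nonneg _) hC0
  have h3 : |∑ k ∈ bad, x k * c k| ≤ |W| / 2 := by
    refine abs_le_of_sq_le_sq ?_ (by positivity)
    rw [div_pow, sq_abs]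
    refine le_of_mul_le_mul_left ?_ hK
    linarith
  have h4 : |W| ≤ |W| / 4 + |W| / 2 := by
    conv_lhs => rw [hsplit]
    exact (abs_add_le _ _).trans (add_le_add h1 h3)
  have h5 : |W| = 0 := le_antisymm (by linarith) (abs_nonneg _)
  rw [abs_eq_zero.1 h5] at hW
  nlinarith [mul_nonneg hC0 hS0]

theorem summable_exp_neg_mul_abs {γ : ℝ} (hγ : 0 < γ) :
    Summable fun n : ℤ => Real.exp (-γ * |(n : ℝ)|) := by
  have h : Summable fun n : ℕ => Real.exp (-γ * n) := by
    have := Real.summable_exp_nat_mul_iff.2 (neg_neg_of_pos hγ)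
    simpa [mul_comm] using this
  refine Summable.of_nat_of_neg ?_ ?_ <;> simpa using h

theorem summable_exp_mul_of_summable_sq {γ : ℝ} (hγ : 0 < γ) {w : ℤ → ℝ}
    (hw : Summable fun n => w n ^ 2) : Summable fun n : ℤ => Real.exp (-γ * |(n : ℝ)|) * |w n| := by
  refine Summable.of_nonneg_of_le (fun n => by positivity) (fun n => ?_)
    ((summable_exp_neg_mul_abs (γ := 2 * γ) (by positivity)).add hw)
  have e : Real.exp (-(2 * γ) * |(n : ℝ)|) = Real.exp (-γ * |(n : ℝ)|) ^ 2 := by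
    rw [← Real.exp_nat_mul]
    push_cast
    ring_nf
  rw [e, ← sq_abs (w n)]
  nlinarith [sq_nonneg (Real.exp (-γ * |(n : ℝ)|) - |w n|), abs_nonneg (w n),
    Real.exp_pos (-γ * |(n : ℝ)|)]

theorem exists_tendsto_ultrafilter (U : Ultrafilter ℕ) {f : ℕ → ℝ} {c d : ℝ}
    (h : ∀ L, f L ∈ Set.Icc c d) : ∃ x ∈ Set.Icc c d, Filter.Tendsto f U (nhds x) := by
  obtain ⟨x, hx, hle⟩ := isCompact_Icc.ultrafilter_le_nhds (U.map f)
    (Filter.tendsto_principal.2 (Filter.Eventually.of_forall h))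
  exact ⟨x, hx, hle⟩

open Filter in
/-- For a suitable small perturbation of the potential, a square summable sequence that is
orthogonal to all exponentially decaying eigenfunctions vanishes at the sites `0` and `1`. -/
theorem exists_potential_complete {a b : ℤ → ℝ} {A B : ℝ} (ha0 : ∀ n, 0 < a n)
    (haA : ∀ n, a n ≤ A) (hb : ∀ n, |b n| ≤ B) {η : ℝ} (hη : 0 < η) :
    ∃ (b' : ℤ → ℝ) (γ : ℝ), 0 < γ ∧ (∀ n, b n ≤ b' n ∧ b' n ≤ b n + 2 * η) ∧
      ∀ w : ℤ → ℝ, Summable (fun n => w n ^ 2) →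
        (∀ (v : ℤ → ℝ) (E : ℝ), (∀ n, jacobiExpr a b' v n = E * v n) →
          (∃ C, ∀ n, |v n| ≤ C * Real.exp (-γ * |(n : ℝ)|)) → ∑' n, v n * w n = 0) →
        w 0 = 0 ∧ w 1 = 0 := by
  obtain ⟨C, γ, M, hC, hγ, hbox⟩ := exists_localized_box ha0 haA hb hη
  choose β N l ψ F hβ hl hF heq hout hdec hsum hcomp using hbox
  -- The limit potential must be fixed before `w` is given. Along an ultrafilter the bounded
  -- sequences selected later in terms of `w` converge too, without passing to further subsequences.
  set U : Ultrafilter ℕ := hyperfilter ℕ with hU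
  have hUtop : (U : Filter ℕ) ≤ atTop := Nat.hyperfilter_le_atTop
  choose b' hb' hlim using fun n : ℤ => exists_tendsto_ultrafilter U (f := fun L => β L n)
    (fun L => ⟨(hβ L n).1, (hβ L n).2⟩)
  refine ⟨b', γ, hγ, fun n => ⟨(hb' n).1, (hb' n).2⟩, fun w hw horth => ?_⟩
  have main : ∀ i : ℤ, (i = 0 ∨ i = 1) → w i = 0 := by
    intro i hi
    by_contra hne
    set S := ∑' n, w n ^ 2 with hS
    have hS0 : 0 ≤ S := tsum_nonneg fun n => sq_nonneg _
    have hwi : 0 < w i ^ 2 := by positivity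
    obtain ⟨K, hK⟩ := exists_gt (max 0 (4 * (C * S) / w i ^ 2))
    have hK0 : 0 < K := (le_max_left _ _).trans_lt hK
    have hKW : 4 * (C * S) < K * w i ^ 2 :=
      (div_lt_iff₀ hwi).1 ((le_max_right _ _).trans_lt hK)
    have hmem : ∀ L : ℕ, ∀ j : ℤ, (j = 0 ∨ j = 1) → j ∈ Finset.Icc (-(L : ℤ)) (L + 1) := by
      intro L j hj
      rw [Finset.mem_Icc]
      omega
    have hone : ∀ L : ℕ, ∀ j : ℤ, (j = 0 ∨ j = 1) → ∑ k, ψ L k j ^ 2 = 1 := by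
      intro L j hj
      have := (hcomp L (fun n => if n = j then 1 else 0)).2
      simpa [hmem L j hj] using this
    have hex : ∀ L : ℕ, ∃ k, F L k ≤ K ∧ |w i| / 8 * √(ψ L k 0 ^ 2 + ψ L k 1 ^ 2)
        < |∑ m ∈ Finset.Icc (-(L : ℤ)) (L + 1), ψ L k m * w m| := by
      intro L
      obtain ⟨h1, h2⟩ := hcomp L w
      have e := h1 i (hmem L i hi)
      have hsq : ∀ k, √(ψ L k 0 ^ 2 + ψ L k 1 ^ 2) ^ 2 = ψ L k 0 ^ 2 + ψ L k 1 ^ 2 :=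
        fun k => Real.sq_sqrt (by positivity)
      have := exists_large_coefficient (x := fun k => ψ L k i)
        (c := fun k => ∑ m ∈ Finset.Icc (-(L : ℤ)) (L + 1), ψ L k m * w m)
        (θ := fun k => √(ψ L k 0 ^ 2 + ψ L k 1 ^ 2)) (F := F L) (C := C) (S := S) hK0
        (fun k => Real.abs_le_sqrt (by
          rcases hi with rfl | rfl
          · nlinarith [sq_nonneg (ψ L k 1)]
          · nlinarith [sq_nonneg (ψ L k 0)]))
        (by
          simp only [hsq]
          rw [Finset.sum_add_distrib, hone L 0 (Or.inl rfl), hone L 1 (Or.inr rfl)]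
          norm_num)
        (hF L) (by simpa only [hsq] using hsum L)
        (h2.le.trans (hw.sum_le_tsum _ fun m _ => sq_nonneg _))
        (by rw [← e]; exact hKW)
      rwa [← e] at this
    choose k hkF hkc using hex
    set θ : ℕ → ℝ := fun L => √(ψ L (k L) 0 ^ 2 + ψ L (k L) 1 ^ 2) with hθ
    -- If `θ L` vanished, the decay bound would annihilate the eigenfunction, contradicting the
    -- strict lower bound on its coefficient.
    have hθ0 : ∀ L, 0 < θ L := by
      intro L
      refine lt_of_le_of_ne (Real.sqrt_nonneg _) fun h0 => ?_
      have hz : ∀ n, ψ L (k L) n = 0 := fun n => by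
        have := hdec L (k L) n
        change _ ≤ C * θ L * _ * _ at this
        rw [← h0] at this
        simpa using this
      have := hkc L
      simp [hz] at this
    set C' := C * (1 + K) with hC'
    have hC'0 : 0 < C' := by positivity
    have hvle : ∀ L n, |ψ L (k L) n / θ L| ≤ C' * Real.exp (-γ * |(n : ℝ)|) := by
      intro L n
      rw [abs_div, abs_of_pos (hθ0 L), div_le_iff₀ (hθ0 L)]
      refine (hdec L (k L) n).trans ?_
      change C * θ L * _ * _ ≤ _
      have := (hθ0 L).le
      have := hF L (k L)
      calc C * θ L * (1 + F L (k L)) * Real.exp (-γ * |(n : ℝ)|)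
          ≤ C * θ L * (1 + K) * Real.exp (-γ * |(n : ℝ)|) := by
            gcongr
            exact hkF L
        _ = _ := by rw [hC']; ring
    choose v hv hvlim using fun n : ℤ => exists_tendsto_ultrafilter U
      (f := fun L => ψ L (k L) n / θ L) (fun L => abs_le.1 (hvle L n))
    obtain ⟨E, -, hElim⟩ := exists_tendsto_ultrafilter U (f := fun L => l L (k L))
      (fun L => abs_le.1 (hl L (k L)))
    have hveq : ∀ n, jacobiExpr a b' v n = E * v n := by
      intro n
      have t1 : Tendsto (fun L => jacobiExpr a (β L) (fun m => ψ L (k L) m / θ L) n) U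
          (nhds (jacobiExpr a b' v n)) := by
        unfold jacobiExpr
        exact (((hvlim _).const_mul _).add ((hvlim _).const_mul _)).add ((hlim n).mul (hvlim n))
      have t2 : Tendsto (fun L => l L (k L) * (ψ L (k L) n / θ L)) U (nhds (E * v n)) :=
        hElim.mul (hvlim n)
      refine tendsto_nhds_unique t1 (t2.congr' ?_)
      have hev : ∀ᶠ L : ℕ in (U : Filter ℕ), n.natAbs ≤ L := hUtop (eventually_ge_atTop _)
      filter_upwards [hev] with L hL
      have h1 := heq L (k L) n (by rw [Finset.mem_Icc]; omega)
      rw [← mul_div_assoc, ← h1]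
      unfold jacobiExpr
      ring
    have hvorth := horth v E hveq ⟨C', fun n => abs_le.2 (hv n)⟩
    -- After division by `θ L` the decay bound is uniform in `L`, so dominated convergence applies
    -- and the lower bound `|w i| / 8` on the overlap passes to the limit.
    have hts : Tendsto (fun L => ∑' n, ψ L (k L) n / θ L * w n) U (nhds (∑' n, v n * w n)) := by
      refine tendsto_tsum_of_dominated_convergence
        ((summable_exp_mul_of_summable_sq hγ hw).mul_left C')
        (fun n => (hvlim n).mul_const _) (Eventually.of_forall fun L n => ?_)
      rw [Real.norm_eq_abs, abs_mul, ← mul_assoc]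
      exact mul_le_mul_of_nonneg_right (hvle L n) (abs_nonneg _)
    rw [hvorth] at hts
    have hlow : ∀ L, |w i| / 8 ≤ |∑' n, ψ L (k L) n / θ L * w n| := by
      intro L
      rw [tsum_eq_sum (s := Finset.Icc (-(L : ℤ)) (L + 1)) (fun n hn => by
        rw [hout L (k L) n hn]; simp)]
      have e : ∑ n ∈ Finset.Icc (-(L : ℤ)) (L + 1), ψ L (k L) n / θ L * w n
          = (∑ n ∈ Finset.Icc (-(L : ℤ)) (L + 1), ψ L (k L) n * w n) / θ L := by
        rw [Finset.sum_div]
        exact Finset.sum_congr rfl fun n _ => by ring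
      rw [e, abs_div, abs_of_pos (hθ0 L), le_div_iff₀ (hθ0 L)]
      exact (hkc L).le
    have := ge_of_tendsto' hts.abs hlow
    rw [abs_zero] at this
    have : 0 < |w i| := abs_pos.2 hne
    linarith
  exact ⟨main 0 (Or.inl rfl), main 1 (Or.inr rfl)⟩

/-! ### Spectral measures and total sets of eigenvectors -/

section SpectralMeasure

variable {H : Type*} [NormedAddCommGroup H] [InnerProductSpace ℂ H] [CompleteSpace H]

theorem spectralFunctional_apply (T : H →L[ℂ] H) (φ : H) (f : C_c(ℝ, ℝ)) :
    spectralFunctional T φ f = (inner ℂ φ (cfc (fun x : ℝ => f x) T φ)).re := rfl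

instance regular_spectralMeasure (T : H →L[ℂ] H) (φ : H) : (spectralMeasure T φ).Regular :=
  RealRMK.regular_rieszMeasure _

theorem spectralMeasure_univ_le (T : H →L[ℂ] H) (φ : H) :
    spectralMeasure T φ Set.univ ≤ ENNReal.ofReal (‖φ‖ ^ 2) := by
  rw [isOpen_univ.measure_eq_iSup_isCompact]
  refine iSup₂_le fun K _ => iSup_le fun hK => ?_
  obtain ⟨f, hf1, -, hfc, hf01⟩ := exists_continuous_one_zero_of_isCompact hK isClosed_empty
    (Set.disjoint_empty K)
  let g : C_c(ℝ, ℝ) := ⟨f, hfc⟩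
  refine (RealRMK.rieszMeasure_le_of_eq_one (spectralFunctional T φ) (f := g)
    (fun x => (hf01 x).1) hK fun x hx => hf1 hx).trans (ENNReal.ofReal_le_ofReal ?_)
  rw [spectralFunctional_apply]
  have h1 : cfc (fun x : ℝ => g x) T ≤ 1 := cfc_le_one _ T fun x _ => (hf01 x).2
  have h2 := ((ContinuousLinearMap.le_def _ _).1 h1).re_inner_nonneg_right φ
  rw [sub_apply, inner_sub_right, one_apply_eq_self, inner_self_eq_norm_sq_to_K] at h2
  simp only [map_sub] at h2
  norm_cast at h2
  have h3 : RCLike.re (inner ℂ φ (cfc (fun x : ℝ => g x) T φ))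
    = (inner ℂ φ (cfc (fun x : ℝ => g x) T φ)).re := rfl
  rw [h3] at h2
  linarith

instance isFiniteMeasure_spectralMeasure (T : H →L[ℂ] H) (φ : H) :
    IsFiniteMeasure (spectralMeasure T φ) :=
  ⟨(spectralMeasure_univ_le T φ).trans_lt ENNReal.ofReal_lt_top⟩

/-- Inherited from the quadratic form `φ ↦ ⟪φ, f(T) φ⟫`. It makes the vectors whose measure vanishes
on a given set closed under addition, with no need for complex off-diagonal measures. -/
theorem spectralMeasure_parallelogram (T : H →L[ℂ] H) (φ ψ : H) :
    spectralMeasure T (φ + ψ) + spectralMeasure T (φ - ψ)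
      = (spectralMeasure T φ + spectralMeasure T φ)
        + (spectralMeasure T ψ + spectralMeasure T ψ) := by
  refine Measure.ext_of_integral_eq_on_compactlySupported fun f => ?_
  have hi : ∀ μ : Measure ℝ, [IsFiniteMeasure μ] → Integrable f μ := fun μ _ =>
    f.continuous.integrable_of_hasCompactSupport f.hasCompactSupport
  rw [integral_add_measure (hi _) (hi _), integral_add_measure (hi _) (hi _),
    integral_add_measure (hi _) (hi _), integral_add_measure (hi _) (hi _)]
  simp only [integral_spectralMeasure, map_add, map_sub, inner_add_left, inner_add_right,
    inner_sub_left, inner_sub_right, Complex.add_re, Complex.sub_re]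
  ring

theorem spectralMeasure_add_le (T : H →L[ℂ] H) (φ ψ : H) (s : Set ℝ) :
    spectralMeasure T (φ + ψ) s ≤ 2 * spectralMeasure T φ s + 2 * spectralMeasure T ψ s := by
  have h := congrArg (fun μ : Measure ℝ => μ s) (spectralMeasure_parallelogram T φ ψ)
  simp only [Measure.add_apply] at h
  rw [two_mul, two_mul, ← h]
  exact le_self_add

/-- The identity is stable under the algebra operations and under limits, so it follows from
Stone–Weierstrass on the spectrum. -/
theorem cfc_apply_eigenvector {T : H →L[ℂ] H} (hT : IsSelfAdjoint T) {u : H} {E : ℝ}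
    (hu : T u = (E : ℂ) • u) {f : ℝ → ℝ} (hf : Continuous f) : cfc f T u = (f E : ℂ) • u := by
  rcases eq_or_ne u 0 with rfl | hu0
  · simp
  have hE : E ∈ spectrum ℝ T := by
    rw [spectrum.mem_iff]
    rintro ⟨v, hv⟩
    have h1 : (v : H →L[ℂ] H) u = 0 := by
      rw [hv, sub_apply, hu, Algebra.algebraMap_eq_smul_one, smul_apply, one_apply_eq_self,
        Complex.coe_smul, sub_self]
    have h2 : ((v⁻¹ : (H →L[ℂ] H)ˣ) : H →L[ℂ] H) ((v : H →L[ℂ] H) u) = u := by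
      rw [← mul_apply_eq_comp, v.inv_mul, one_apply_eq_self]
    rw [h1, map_zero] at h2
    exact hu0 h2.symm
  have : CompactSpace (spectrum ℝ T) := isCompact_iff_compactSpace.1 (spectrum.isCompact T)
  have key : ∀ g : C(spectrum ℝ T, ℝ), cfcHom hT g u = (g ⟨E, hE⟩ : ℂ) • u := by
    intro g
    induction g using ContinuousMap.induction_on_of_compact with
    | const r =>
      have : ContinuousMap.const (spectrum ℝ T) r = algebraMap ℝ C(spectrum ℝ T, ℝ) r := rfl
      rw [this, AlgHomClass.commutes, Algebra.algebraMap_eq_smul_one, smul_apply,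
        one_apply_eq_self, ← Complex.coe_smul]
      rfl
    | id =>
      rw [cfcHom_id hT]
      exact hu
    | star_id =>
      rw [map_star, cfcHom_id hT, hT.star_eq]
      exact hu
    | add f g hf hg => rw [map_add, add_apply, hf, hg, ← add_smul]; simp
    | mul f g hf hg =>
      rw [map_mul, mul_apply_eq_comp, hg, map_smul, hf, smul_smul, mul_comm]
      simp
    | frequently f hf =>
      have hc : IsClosed {g : C(spectrum ℝ T, ℝ) | cfcHom hT g u = (g ⟨E, hE⟩ : ℂ) • u} := by
        refine isClosed_eq ?_ ?_
        · exact (ContinuousLinearMap.apply ℂ H u).continuous.comp (cfcHom_continuous hT)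
        · exact (Complex.continuous_ofReal.comp (continuous_eval_const _)).smul
            continuous_const
      exact hc.closure_subset (mem_closure_iff_frequently.2 hf)
  rw [cfc_apply f T hT hf.continuousOn]
  exact key _

theorem spectralMeasure_eigenvector {T : H →L[ℂ] H} (hT : IsSelfAdjoint T) {u : H} {E : ℝ}
    (hu : T u = (E : ℂ) • u) :
    spectralMeasure T u = ENNReal.ofReal (‖u‖ ^ 2) • Measure.dirac E := by
  have : IsFiniteMeasure (ENNReal.ofReal (‖u‖ ^ 2) • Measure.dirac E) :=
    Measure.smul_finite _ ENNReal.ofReal_ne_top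
  refine Measure.ext_of_integral_eq_on_compactlySupported fun f => ?_
  rw [integral_spectralMeasure, cfc_apply_eigenvector (f := fun x : ℝ => f x) hT hu f.continuous, inner_smul_right,
    inner_self_eq_norm_sq_to_K, integral_smul_measure, integral_dirac,
    ENNReal.toReal_ofReal (sq_nonneg _)]
  norm_cast
  rw [smul_eq_mul, mul_comm]
  exact Complex.re_ofReal_mul _ _

/-- If the eigenvectors of a self-adjoint operator with eigenvalues in `S` are total, then all
spectral measures are concentrated on `S`. -/
theorem spectralMeasure_compl_eq_zero {T : H →L[ℂ] H} (hT : IsSelfAdjoint T) {S : Set ℝ}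
    {s : Set H} (hs : ∀ u ∈ s, ∃ E ∈ S, T u = (E : ℂ) • u)
    (hdense : ∀ w : H, (∀ u ∈ s, inner ℂ u w = 0) → w = 0) (φ : H) :
    spectralMeasure T φ Sᶜ = 0 := by
  have heig : ∀ u : H, (∃ E ∈ S, T u = (E : ℂ) • u) → spectralMeasure T u Sᶜ = 0 := by
    rintro u ⟨E, hE, hu⟩
    rw [spectralMeasure_eigenvector hT hu, Measure.smul_apply, Measure.dirac_apply]
    simp [hE]
  have hspan : ∀ ψ ∈ Submodule.span ℂ s, spectralMeasure T ψ Sᶜ = 0 := by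
    intro ψ hψ
    induction hψ using Submodule.closure_induction with
    | zero =>
      refine le_antisymm ((measure_mono (Set.subset_univ _)).trans
        ((spectralMeasure_univ_le T 0).trans ?_)) zero_le
      simp
    | add x y _ _ hx hy =>
      refine le_antisymm ((spectralMeasure_add_le T x y _).trans ?_) zero_le
      rw [hx, hy]
      simp
    | smul_mem r x hx =>
      obtain ⟨E, hE, hu⟩ := hs x hx
      exact heig _ ⟨E, hE, by rw [map_smul, hu, smul_comm]⟩
  have htop : (Submodule.span ℂ s).topologicalClosure = ⊤ := by
    rw [Submodule.topologicalClosure_eq_top_iff, Submodule.eq_bot_iff]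
    intro w hw
    exact hdense w fun u hu => (Submodule.mem_orthogonal _ _).1 hw u (Submodule.subset_span hu)
  have hφ : φ ∈ closure (Submodule.span ℂ s : Set H) := by
    rw [← Submodule.topologicalClosure_coe, htop]
    trivial
  -- For `ψ` in the span the mass of `Sᶜ` at `φ` is at most `2 * ‖φ - ψ‖ ^ 2`.
  have hle : ∀ r : ℝ, 0 < r → spectralMeasure T φ Sᶜ ≤ ENNReal.ofReal r := by
    intro r hr
    obtain ⟨ψ, hψ, hd⟩ := Metric.mem_closure_iff.1 hφ (√(r / 2)) (Real.sqrt_pos.2 (by linarith))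
    have h := spectralMeasure_add_le T ψ (φ - ψ) Sᶜ
    rw [add_sub_cancel, hspan ψ hψ, mul_zero, zero_add] at h
    refine h.trans ((mul_le_mul_right ((measure_mono (Set.subset_univ _)).trans
      (spectralMeasure_univ_le T (φ - ψ))) 2).trans ?_)
    rw [show (2 : ℝ≥0∞) = ENNReal.ofReal 2 by simp, ← ENNReal.ofReal_mul zero_le_two]
    refine ENNReal.ofReal_le_ofReal ?_
    rw [dist_eq_norm] at hd
    have := (Real.le_sqrt (norm_nonneg _) (by linarith)).1 hd.le
    linarith
  by_contra hne
  obtain ⟨r, hr0, hr⟩ := ENNReal.lt_iff_exists_real_btwn.1 (pos_iff_ne_zero.2 hne)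
  exact (hr.2.trans_le (hle r (ENNReal.ofReal_pos.1 hr.1))).false

end SpectralMeasure

/-! ### Eigenfunctions of Jacobi operators on ℓ²(ℤ) -/

section Jacobi

theorem isSelfAdjoint_jacobi (a b : EllInfty) : IsSelfAdjoint (jacobi a b) := by
  rw [ContinuousLinearMap.isSelfAdjoint_iff_isSymmetric]
  have hmul : ∀ (c : EllInfty) (φ ψ : EllTwo), inner ℂ (mulOp c φ) ψ = inner ℂ φ (mulOp c ψ) := by
    intro c φ ψ
    rw [lp.inner_eq_tsum, lp.inner_eq_tsum]
    refine tsum_congr fun n => ?_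
    change inner ℂ ((c n : ℂ) * φ n) (ψ n) = inner ℂ (φ n) ((c n : ℂ) * ψ n)
    simp only [RCLike.inner_apply, map_mul, Complex.conj_ofReal]
    ring
  have hshift : ∀ (k : ℤ) (φ ψ : EllTwo),
      inner ℂ (shiftOp k φ) ψ = inner ℂ φ (shiftOp (-k) ψ) := by
    intro k φ ψ
    rw [lp.inner_eq_tsum, lp.inner_eq_tsum, ← (Equiv.addRight k).tsum_eq
      (fun n => inner ℂ (φ n) (shiftOp (-k) ψ n))]
    refine tsum_congr fun n => ?_
    change inner ℂ (φ (n + k)) (ψ n) = inner ℂ (φ (n + k)) (ψ (n + k + -k))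
    rw [add_neg_cancel_right]
  intro φ ψ
  change inner ℂ (mulOp a (shiftOp 1 φ) + shiftOp (-1) (mulOp a φ) + mulOp b φ) ψ
    = inner ℂ φ (mulOp a (shiftOp 1 ψ) + shiftOp (-1) (mulOp a ψ) + mulOp b ψ)
  rw [inner_add_left, inner_add_left, inner_add_right, inner_add_right, hmul, hmul, hshift, hshift,
    hmul, neg_neg]
  ring

theorem eq_zero_of_jacobi_eigen {a b : EllInfty} (ha : ∀ n, 0 < a n) {E : ℂ} {u : EllTwo}
    (hu : jacobi a b u = E • u) (h0 : u 0 = 0) (h1 : u 1 = 0) : u = 0 := by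
  have hn : ∀ n, (a n : ℂ) * u (n + 1) + a (n - 1) * u (n - 1) + b n * u n = E * u n := by
    intro n
    rw [← jacobi_apply, hu]
    rfl
  have hne : ∀ n, (a n : ℂ) ≠ 0 := fun n => Complex.ofReal_ne_zero.2 (ha n).ne'
  have key : ∀ n : ℤ, u n = 0 ∧ u (n + 1) = 0 := by
    intro n
    induction n using Int.induction_on with
    | zero => exact ⟨h0, h1⟩
    | succ i ih =>
      refine ⟨ih.2, ?_⟩
      have h := hn (i + 1)
      rw [add_sub_cancel_right, ih.1, ih.2] at h
      simpa [hne] using h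
    | pred i ih =>
      rw [sub_add_cancel]
      refine ⟨?_, ih.1⟩
      have h := hn (-i)
      rw [ih.1, ih.2] at h
      simpa [hne] using h
  ext n
  exact (key n).1

theorem jacobi_inner_left (a b : EllInfty) (u v : EllTwo) :
    inner ℂ (jacobi a b u) v = inner ℂ u (jacobi a b v) :=
  (ContinuousLinearMap.isSelfAdjoint_iff_isSymmetric.1 (isSelfAdjoint_jacobi a b)) u v

theorem inner_eq_zero_of_jacobi_eigen {a b : EllInfty} {E : ℝ} {E' : ℂ} {u v : EllTwo}
    (hu : jacobi a b u = (E : ℂ) • u) (hv : jacobi a b v = E' • v) (h : (E : ℂ) ≠ E') :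
    inner ℂ u v = 0 := by
  have h1 := jacobi_inner_left a b u v
  rw [hu, hv, inner_smul_left, inner_smul_right, Complex.conj_ofReal] at h1
  have h2 : ((E : ℂ) - E') * inner ℂ u v = 0 := by rw [sub_mul, h1, sub_self]
  exact (mul_eq_zero.1 h2).resolve_left (sub_ne_zero.2 h)

/-- Normalized eigenvectors of distinct eigenvalues are orthonormal, and each is nonzero at `0` or
at `1`. By Bessel's inequality only countably many members of an orthonormal family are nonzero at a
given site. -/
theorem countable_eigenvalues_jacobi {a b : EllInfty} (ha : ∀ n, 0 < a n) :
    {E : ℝ | ∃ u : EllTwo, u ≠ 0 ∧ jacobi a b u = (E : ℂ) • u}.Countable := by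
  set S := {E : ℝ | ∃ u : EllTwo, u ≠ 0 ∧ jacobi a b u = (E : ℂ) • u} with hS
  have hex : ∀ E : S, ∃ u : EllTwo, ‖u‖ = 1 ∧ jacobi a b u = ((E : ℝ) : ℂ) • u := by
    rintro ⟨E, u, hu0, hu⟩
    refine ⟨((‖u‖⁻¹ : ℝ) : ℂ) • u, ?_,
      (map_smul _ _ _).trans ((congrArg _ hu).trans (smul_comm _ _ _))⟩
    rw [norm_smul, Complex.norm_real, norm_inv, norm_norm, inv_mul_cancel₀ (norm_ne_zero_iff.2 hu0)]
  choose u hu1 hu using hex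
  have hon : Orthonormal ℂ u := ⟨hu1, fun E E' hne => inner_eq_zero_of_jacobi_eigen (hu E) (hu E')
    fun h => hne (Subtype.ext (Complex.ofReal_injective h))⟩
  have hc : ∀ n : ℤ, {E : S | u E n ≠ 0}.Countable := by
    intro n
    have h := (hon.inner_products_summable (lp.single 2 n (1 : ℂ))).countable_support
    refine h.mono fun E hE => ?_
    rw [Function.mem_support]
    refine pow_ne_zero 2 (norm_ne_zero_iff.2 ?_)
    rw [← inner_conj_symm, lp.inner_single_left]
    simpa using hE
  have huniv : (Set.univ : Set S) = {E : S | u E 0 ≠ 0} ∪ {E : S | u E 1 ≠ 0} := by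
    refine (Set.eq_univ_of_forall fun E => ?_).symm
    by_contra h
    rw [Set.mem_union, not_or] at h
    have := eq_zero_of_jacobi_eigen ha (hu E) (not_not.1 h.1) (not_not.1 h.2)
    have h1 := hu1 E
    rw [this, norm_zero] at h1
    exact zero_ne_one h1
  rw [← Set.countable_coe_iff, ← Set.countable_univ_iff, huniv]
  exact (hc 0).union (hc 1)

theorem tendsto_cofinite_ellTwo (u : EllTwo) :
    Filter.Tendsto (fun n => u n) Filter.cofinite (nhds 0) := by
  have h : (0 : ℝ) < (2 : ℝ≥0∞).toReal := by norm_num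
  have h1 := ((memℓp_gen_iff h).1 (lp.memℓp u)).tendsto_cofinite_zero
  rw [tendsto_zero_iff_norm_tendsto_zero]
  have h2 := h1.rpow_const (p := (2 : ℝ)⁻¹) (Or.inr (by norm_num))
  rw [Real.zero_rpow (by norm_num)] at h2
  refine h2.congr fun n => ?_
  rw [← Real.rpow_mul (norm_nonneg _)]
  norm_num

/-- The eigenvalues of a Jacobi operator are simple, by constancy of the Wronskian. -/
theorem exists_eq_smul_of_jacobi_eigen {a b : EllInfty} (ha : ∀ n, 0 < a n) {E : ℂ}
    {u v : EllTwo} (hu : jacobi a b u = E • u) (hv : jacobi a b v = E • v) (hv0 : v ≠ 0) :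
    ∃ c : ℂ, u = c • v := by
  have hrec : ∀ w : EllTwo, jacobi a b w = E • w → ∀ n,
      (a n : ℂ) * w (n + 1) + a (n - 1) * w (n - 1) + b n * w n = E * w n := by
    intro w hw n
    rw [← jacobi_apply, hw]
    rfl
  set W : ℤ → ℂ := fun n => a n * (u (n + 1) * v n - u n * v (n + 1)) with hW
  have hstep : ∀ n, W n = W (n - 1) := by
    intro n
    have h1 := hrec u hu n
    have h2 := hrec v hv n
    simp only [hW, sub_add_cancel]
    linear_combination v n * h1 - u n * h2
  have hconst : ∀ n, W n = W 0 := by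
    intro n
    induction n using Int.induction_on with
    | zero => rfl
    | succ i ih => rw [hstep, add_sub_cancel_right, ih]
    | pred i ih => rw [← hstep, ih]
  -- Square summability forces the constant Wronskian to be zero, so the initial data of `u` and `v`
  -- at `0` and `1` are proportional.
  have hlim : Filter.Tendsto W Filter.cofinite (nhds 0) := by
    have hs : ∀ w : EllTwo, Filter.Tendsto (fun n => w (n + 1)) Filter.cofinite (nhds 0) :=
      fun w => (tendsto_cofinite_ellTwo w).comp (add_left_injective (1 : ℤ)).tendsto_cofinite
    have h := ((hs u).mul (tendsto_cofinite_ellTwo v)).sub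
      ((tendsto_cofinite_ellTwo u).mul (hs v))
    rw [mul_zero, sub_zero] at h
    refine Filter.Tendsto.zero_mul_isBoundedUnder_le h ?_ |>.congr fun n => mul_comm _ _
    exact Filter.isBoundedUnder_of ⟨‖a‖, fun n => by
      change ‖(a n : ℂ)‖ ≤ ‖a‖
      rw [Complex.norm_real]
      exact lp.norm_apply_le_norm ENNReal.top_ne_zero a n⟩
  have hW0 : W 0 = 0 :=
    tendsto_nhds_unique (tendsto_const_nhds.congr fun n => (hconst n).symm) hlim
  have hwr : u 1 * v 0 = u 0 * v 1 := by
    have h := hW0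
    simp only [hW, zero_add] at h
    exact sub_eq_zero.1 ((mul_eq_zero.1 h).resolve_left (Complex.ofReal_ne_zero.2 (ha 0).ne'))
  have hcomb : ∀ c : ℂ, jacobi a b (u - c • v) = E • (u - c • v) := by
    intro c
    rw [map_sub, map_smul, hu, hv, smul_sub, smul_comm]
  by_cases h0 : v 0 = 0
  · have h1 : v 1 ≠ 0 := fun h1 => hv0 (eq_zero_of_jacobi_eigen ha hv h0 h1)
    refine ⟨u 1 / v 1, sub_eq_zero.1 (eq_zero_of_jacobi_eigen ha (hcomb _) ?_ ?_)⟩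
    · have h2 : u 0 = 0 := by
        rw [h0, mul_zero] at hwr
        exact (mul_eq_zero.1 hwr.symm).resolve_right h1
      change u 0 - u 1 / v 1 * v 0 = 0
      rw [h0, h2]
      simp
    · change u 1 - u 1 / v 1 * v 1 = 0
      rw [div_mul_cancel₀ _ h1, sub_self]
  · refine ⟨u 0 / v 0, sub_eq_zero.1 (eq_zero_of_jacobi_eigen ha (hcomb _) ?_ ?_)⟩
    · change u 0 - u 0 / v 0 * v 0 = 0
      rw [div_mul_cancel₀ _ h0, sub_self]
    · change u 1 - u 0 / v 0 * v 1 = 0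
      rw [div_mul_eq_mul_div, ← hwr, mul_div_cancel_right₀ _ h0, sub_self]

/-- A set of vectors is total if its orthogonal complement is invariant under a Jacobi operator and
its elements vanish at `0` and `1`. -/
theorem eq_zero_of_jacobi_invariant {a b : EllInfty} (ha : ∀ n, 0 < a n) {P : EllTwo → Prop}
    (hinv : ∀ w, P w → P (jacobi a b w)) (h01 : ∀ w, P w → w 0 = 0 ∧ w 1 = 0) {w : EllTwo}
    (hw : P w) : w = 0 := by
  have hne : ∀ n, (a n : ℂ) ≠ 0 := fun n => Complex.ofReal_ne_zero.2 (ha n).ne'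
  have key : ∀ m : ℕ, ∀ w, P w → ∀ n : ℤ, -m ≤ n → n ≤ m + 1 → w n = 0 := by
    intro m
    induction m with
    | zero =>
      intro w hw n h1 h2
      have : n = 0 ∨ n = 1 := by push_cast at h1 h2; omega
      rcases this with rfl | rfl
      · exact (h01 w hw).1
      · exact (h01 w hw).2
    | succ m ih =>
      intro w hw n h1 h2
      have hw0 := ih w hw
      have hJ := ih _ (hinv w hw)
      push_cast at h1 h2
      -- Both `w` and its image vanish on `[-m, m + 1]`; the recurrence at either end, with nonzero
      -- coupling, gives one further zero on that side.
      by_cases h3 : n = m + 2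
      · have h := hJ (m + 1) (by omega) (by omega)
        rw [jacobi_apply, hw0 (m + 1) (by omega) (by omega),
          hw0 (m + 1 - 1) (by omega) (by omega)] at h
        rw [h3, show (m : ℤ) + 2 = m + 1 + 1 by ring]
        simpa [hne] using h
      by_cases h4 : n = -m - 1
      · have h := hJ (-m) (by omega) (by omega)
        rw [jacobi_apply, hw0 (-m) (by omega) (by omega),
          hw0 (-m + 1) (by omega) (by omega)] at h
        rw [h4]
        simpa [hne] using h
      · exact hw0 n (by omega) (by omega)
  ext n
  exact key n.natAbs w hw n (by omega) (by omega)

end Jacobi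

/-! ### From totality to localization -/

section Localization

theorem memℓp_two_of_exp_decay {γ C : ℝ} (hγ : 0 < γ) {v : ℤ → ℂ}
    (hv : ∀ n : ℤ, ‖v n‖ ≤ C * Real.exp (-γ * |(n : ℝ)|)) : Memℓp v 2 := by
  have h : (0 : ℝ) < (2 : ℝ≥0∞).toReal := by norm_num
  rw [memℓp_gen_iff h]
  refine .of_nonneg_of_le (fun n => by positivity) (fun n => ?_)
    ((summable_exp_neg_mul_abs (γ := 2 * γ) (by linarith)).mul_left (C ^ 2))
  rw [show (2 : ℝ≥0∞).toReal = ((2 : ℕ) : ℝ) by norm_num, Real.rpow_natCast]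
  refine (pow_le_pow_left₀ (norm_nonneg _) (hv n) 2).trans_eq ?_
  rw [mul_pow, ← Real.exp_nat_mul]
  push_cast
  ring_nf

theorem summable_sq_norm_ellTwo (w : EllTwo) : Summable fun n => ‖w n‖ ^ 2 := by
  have h : (0 : ℝ) < (2 : ℝ≥0∞).toReal := by norm_num
  refine ((memℓp_gen_iff h).1 (lp.memℓp w)).congr fun n => ?_
  rw [show (2 : ℝ≥0∞).toReal = ((2 : ℕ) : ℝ) by norm_num, Real.rpow_natCast]

/-- Self-adjointness makes orthogonality to the decaying eigenfunctions an invariant condition. Real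
eigenfunctions suffice to test it, so the real and imaginary parts of `w` can be treated separately.
-/
theorem eq_zero_of_inner_exp_decaying {a b : EllInfty} (ha : ∀ n, 0 < a n) {γ : ℝ} (hγ : 0 < γ)
    (h : ∀ w : ℤ → ℝ, Summable (fun n => w n ^ 2) →
      (∀ (v : ℤ → ℝ) (E : ℝ), (∀ n, jacobiExpr a b v n = E * v n) →
        (∃ C, ∀ n, |v n| ≤ C * Real.exp (-γ * |(n : ℝ)|)) → ∑' n, v n * w n = 0) →
      w 0 = 0 ∧ w 1 = 0) {w : EllTwo}
    (hw : ∀ (v : EllTwo) (E : ℝ), jacobi a b v = (E : ℂ) • v →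
      (∃ C, ∀ n : ℤ, ‖v n‖ ≤ C * Real.exp (-γ * |(n : ℝ)|)) → inner ℂ v w = 0) :
    w = 0 := by
  refine eq_zero_of_jacobi_invariant (b := b) ha (P := fun w => ∀ (v : EllTwo) (E : ℝ),
    jacobi a b v = (E : ℂ) • v → (∃ C, ∀ n : ℤ, ‖v n‖ ≤ C * Real.exp (-γ * |(n : ℝ)|)) →
      inner ℂ v w = 0) ?_ ?_ hw
  · intro w hw v E hv hC
    rw [← jacobi_inner_left, hv, inner_smul_left, hw v E hv hC, mul_zero]
  intro w hw
  have hsum : ∀ (v : ℤ → ℝ) (E : ℝ), (∀ n, jacobiExpr a b v n = E * v n) →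
      (∃ C, ∀ n, |v n| ≤ C * Real.exp (-γ * |(n : ℝ)|)) →
      HasSum (fun n => (v n : ℂ) * w n) 0 := by
    rintro v E hv ⟨C, hC⟩
    have hC' : ∀ n : ℤ, ‖(v n : ℂ)‖ ≤ C * Real.exp (-γ * |(n : ℝ)|) := fun n => by
      rw [Complex.norm_real]
      exact hC n
    let V : EllTwo := ⟨fun n => (v n : ℂ), memℓp_two_of_exp_decay hγ hC'⟩
    have hV : jacobi a b V = (E : ℂ) • V := by
      ext n
      rw [jacobi_apply]
      change (a n : ℂ) * v (n + 1) + a (n - 1) * v (n - 1) + b n * v n = E * v n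
      exact_mod_cast hv n
    have h1 := lp.hasSum_inner (𝕜 := ℂ) V w
    rw [hw V E hV ⟨C, hC'⟩] at h1
    refine h1.congr_fun fun n => ?_
    change (v n : ℂ) * w n = inner ℂ (v n : ℂ) (w n)
    simp [RCLike.inner_apply, mul_comm]
  have hre := h (fun n => (w n).re)
    (.of_nonneg_of_le (fun n => sq_nonneg _)
      (fun n => sq_le_sq' (neg_le_of_abs_le (Complex.abs_re_le_norm _)) (Complex.re_le_norm _))
      (summable_sq_norm_ellTwo w))
    fun v E hv hC => by
      have := (hsum v E hv hC).mapL Complex.reCLM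
      simpa using this.tsum_eq
  have him := h (fun n => (w n).im)
    (.of_nonneg_of_le (fun n => sq_nonneg _)
      (fun n => sq_le_sq' (neg_le_of_abs_le (Complex.abs_im_le_norm _)) (Complex.im_le_norm _))
      (summable_sq_norm_ellTwo w))
    fun v E hv hC => by
      have := (hsum v E hv hC).mapL Complex.imCLM
      simpa using this.tsum_eq
  exact ⟨Complex.ext hre.1 him.1, Complex.ext hre.2 him.2⟩

theorem hasPurelyPurePointSpectrum_jacobi {a b : EllInfty} (ha : ∀ n, 0 < a n) {γ : ℝ}
    (htot : ∀ w : EllTwo, (∀ (v : EllTwo) (E : ℝ), jacobi a b v = (E : ℂ) • v →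
      (∃ C, ∀ n : ℤ, ‖v n‖ ≤ C * Real.exp (-γ * |(n : ℝ)|)) → inner ℂ v w = 0) → w = 0) :
    HasPurelyPurePointSpectrum (jacobi a b) := by
  refine ⟨isSelfAdjoint_jacobi a b, fun φ => ⟨_, countable_eigenvalues_jacobi (b := b) ha,
    spectralMeasure_compl_eq_zero (isSelfAdjoint_jacobi a b)
      (s := {v | v ≠ 0 ∧ ∃ E : ℝ, jacobi a b v = (E : ℂ) • v}) ?_ ?_ φ⟩⟩
  · rintro v ⟨hv0, E, hv⟩
    exact ⟨E, ⟨v, hv0, hv⟩, hv⟩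
  · intro w hw
    refine htot w fun v E hv _ => ?_
    rcases eq_or_ne v 0 with rfl | hv0
    · exact inner_zero_left _
    · exact hw v ⟨hv0, E, hv⟩

/-- By totality an eigenfunction is not orthogonal to some decaying one. The two then share their
eigenvalue, and by simplicity they are proportional. -/
theorem hasExpDecayingEigenfunctions_jacobi {a b : EllInfty} (ha : ∀ n, 0 < a n) {γ : ℝ}
    (hγ : 0 < γ)
    (htot : ∀ w : EllTwo, (∀ (v : EllTwo) (E : ℝ), jacobi a b v = (E : ℂ) • v →
      (∃ C, ∀ n : ℤ, ‖v n‖ ≤ C * Real.exp (-γ * |(n : ℝ)|)) → inner ℂ v w = 0) → w = 0) :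
    HasExpDecayingEigenfunctions (jacobi a b) := by
  refine ⟨γ, hγ, fun E u hu => ?_⟩
  have hu1 : jacobi a b u = E • u := hu.apply_eq_smul
  have hne : ∃ (v : EllTwo) (E' : ℝ), jacobi a b v = (E' : ℂ) • v ∧
      (∃ C, ∀ n : ℤ, ‖v n‖ ≤ C * Real.exp (-γ * |(n : ℝ)|)) ∧ inner ℂ v u ≠ 0 := by
    by_contra! hcon
    exact hu.2 (htot u hcon)
  obtain ⟨v, E', hv, ⟨C, hC⟩, hin⟩ := hne
  have hE : (E' : ℂ) = E := by
    by_contra h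
    exact hin (inner_eq_zero_of_jacobi_eigen hv hu1 h)
  have hv0 : v ≠ 0 := by
    rintro rfl
    exact hin (inner_zero_left _)
  obtain ⟨c, rfl⟩ := exists_eq_smul_of_jacobi_eigen ha hu1 (hE ▸ hv) hv0
  refine ⟨‖c‖ * C, fun m => ?_⟩
  change ‖c * v m‖ ≤ _
  rw [norm_mul, mul_assoc]
  exact mul_le_mul_of_nonneg_left (hC m) (norm_nonneg c)

end Localization

theorem theorem2p0 (a b : EllInfty) (δ : ℝ) (hδ : 0 < δ) (ha : ∀ n : ℤ, δ ≤ a n)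
    (ε : ℝ) (hε : 0 < ε) :
    ∃ a' b' : EllInfty,
      (∃ δ' : ℝ, 0 < δ' ∧ ∀ n : ℤ, δ' ≤ a' n) ∧
      ‖a' - a‖ < ε ∧ ‖b' - b‖ < ε ∧
      HasPurelyPurePointSpectrum (jacobi a' b') ∧
      HasExpDecayingEigenfunctions (jacobi a' b') := by
  have ha0 : ∀ n, 0 < a n := fun n => hδ.trans_le (ha n)
  have hbd : ∀ (c : EllInfty) n, |c n| ≤ ‖c‖ := fun c n =>
    lp.norm_apply_le_norm ENNReal.top_ne_zero c n
  -- The perturbation may reach `2 * η`, so `η = ε / 3` keeps it strictly below `ε`; the couplings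
  -- `a` are retained.
  obtain ⟨b', γ, hγ, hb', h⟩ := exists_potential_complete ha0
    (fun n => (le_abs_self _).trans (hbd a n)) (hbd b) (η := ε / 3) (by linarith)
  have hclose : ∀ n, |b' n - b n| ≤ 2 * (ε / 3) := fun n =>
    abs_le.2 ⟨by linarith [(hb' n).1], by linarith [(hb' n).2]⟩
  have hmem : Memℓp b' ∞ := by
    refine memℓp_infty ⟨2 * (ε / 3) + ‖b‖, ?_⟩
    rintro _ ⟨n, rfl⟩
    calc ‖b' n‖ = |(b' n - b n) + b n| := by rw [sub_add_cancel, Real.norm_eq_abs]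
      _ ≤ |b' n - b n| + |b n| := abs_add_le _ _
      _ ≤ _ := add_le_add (hclose n) (hbd b n)
  have htot : ∀ w : EllTwo, (∀ (v : EllTwo) (E : ℝ), jacobi a ⟨b', hmem⟩ v = (E : ℂ) • v →
      (∃ C, ∀ n : ℤ, ‖v n‖ ≤ C * Real.exp (-γ * |(n : ℝ)|)) → inner ℂ v w = 0) → w = 0 :=
    fun w hw => eq_zero_of_inner_exp_decaying ha0 hγ h hw
  refine ⟨a, ⟨b', hmem⟩, ⟨δ, hδ, ha⟩, by rwa [sub_self, norm_zero], ?_,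
    hasPurelyPurePointSpectrum_jacobi ha0 htot, hasExpDecayingEigenfunctions_jacobi ha0 hγ htot⟩
  refine (lp.norm_le_of_forall_le (C := 2 * (ε / 3)) (by linarith) fun n => ?_).trans_lt
    (by linarith)
  exact hclose n
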